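/- Let $\Gamma$ be a standard quantum graph: a connected metric graph with finitely many vertices and edges (at least one edge; loops and multiple edges are allowed), with no vertex of degree two, equipped with the Laplacian $-\frac{d^2}{dx^2}$ on each edge and Neumann (Kirchhoff) conditions at all vertices (continuity, and the outgoing derivatives at each vertex sum to zero). Let $L_{\min}$ be its minimal edge length. Let $k>\frac{\pi}{L_{\min}}$ and let $f$ be a generic eigenfunction with eigenvalue $k^2$, that is, the eigenvalue is simple, $f$ vanishes at no vertex, and no outgoing derivative of $f$ vanishes at a vertex of degree different from one. Let $\Omega_D$ be a nodal domain of $f$, i.e. a connected component of $\Gamma$ with the nodal points (the zeros of $f$ in the interior of edges) removed, regarded as a metric graph with a vertex of degree one added at each of its ends at a nodal point. Let $|\Omega_D|$ be its total length, $\rho(\Omega_D)=\frac{|\Omega_D|\,k}{\pi}$ its wavelength capacity, $\xi(\Omega_D)$ the number of points of $\Omega_D$ in the interior of edges at which $f'=0$ (the Neumann count), and $|\partial\Omega_D|$ the number of its vertices of degree one. Then $\xi(\Omega_D)$ and $|\partial\Omega_D|$ are finite and $$\xi(\Omega_D)\le|\partial\Omega_D|-1,$$ $$\tfrac12\bigl(\xi(\Omega_D)+1\bigr)\le\rho(\Omega_D)\le\tfrac12\bigl(\xi(\Omega_D)+|\partial\Omega_D|-1\bigr)\le|\partial\Omega_D|-1.$$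 If moreover $\Omega_D$ contains no vertex of $\Gamma$ of degree one (so that $f$ vanishes at every boundary point of $\Omega_D$), then also $1\le\xi(\Omega_D)$, and hence $1\le\frac12(\xi(\Omega_D)+1)$. -/

import Mathlib

open Set Filter Topology MeasureTheory

/-- A finite metric multigraph with vertex set `V` and edge set `E`. The edge `e` is identified
with the interval `[0, len e]`; `endpt e false` is the vertex at `0` and `endpt e true` is the
vertex at `len e`. Loops and multiple edges are allowed. -/
structure MetricGraph (V E : Type*) where
  endpt : E → Bool → V
  len : E → ℝ
  len_pos : ∀ e, 0 < len e

namespace MetricGraph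

variable {V E : Type*}

/-- The points of the metric graph: the vertices and the interior points of the edges. -/
def Pt (Γ : MetricGraph V E) : Type _ := V ⊕ (Σ e : E, Ioo (0 : ℝ) (Γ.len e))

/-- A vertex as a point of the metric graph. -/
def vtx (Γ : MetricGraph V E) (v : V) : Γ.Pt := Sum.inl v

/-- An interior point of an edge as a point of the metric graph. -/
def innerPt (Γ : MetricGraph V E) (q : Σ e : E, Ioo (0 : ℝ) (Γ.len e)) : Γ.Pt := Sum.inr q

open Classical in
/-- The parametrization `[0, len e] → Γ` of the edge `e` by arc length (extended to all of `ℝ`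
as constant to the left of `0` and to the right of `len e`). -/
noncomputable def pt (Γ : MetricGraph V E) (e : E) (x : ℝ) : Γ.Pt :=
  if h₀ : x ≤ 0 then Γ.vtx (Γ.endpt e false)
  else if h₁ : Γ.len e ≤ x then Γ.vtx (Γ.endpt e true)
  else Γ.innerPt ⟨e, ⟨x, mem_Ioo.2 ⟨lt_of_not_ge h₀, lt_of_not_ge h₁⟩⟩⟩

/-- The quotient topology: `Γ` is the disjoint union of the intervals `[0, len e]`, glued along
the end points that belong to the same vertex. -/
noncomputable instance (Γ : MetricGraph V E) : TopologicalSpace Γ.Pt :=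
  TopologicalSpace.coinduced
    (fun q : (Σ e : E, Icc (0 : ℝ) (Γ.len e)) => Γ.pt q.1 q.2) inferInstance

/-- The degree of a vertex: the number of edge ends at `v` (a loop counts twice). -/
noncomputable def degree (Γ : MetricGraph V E) (v : V) : ℕ :=
  {h : E × Bool | Γ.endpt h.1 h.2 = v}.ncard

/-- The minimal edge length `L_min`. -/
noncomputable def minLen (Γ : MetricGraph V E) : ℝ := ⨅ e, Γ.len e

/-- A standard graph: connected, with at least one edge, and without vertices of degree two.
(Finiteness of `V` and `E` is asked for separately; the vertex conditions are in
`IsEigenfunction`.) -/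
structure IsStandard (Γ : MetricGraph V E) : Prop where
  nonempty_edges : Nonempty E
  connected : ConnectedSpace Γ.Pt
  degree_ne_two : ∀ v, Γ.degree v ≠ 2

/-- The restriction `f|_e` of a function on `Γ` to the edge `e`, as a function of `x ∈ [0, len e]`.
-/
noncomputable def onEdge (Γ : MetricGraph V E) (f : Γ.Pt → ℂ) (e : E) : ℝ → ℂ :=
  fun x => f (Γ.pt e x)

/-- `u` belongs to the Sobolev space `H²([0, l])` and has second derivative `w ∈ L²([0, l])`:
`u` is the integral of a function `v`, which is the integral of `w`. -/
def HasSecondDeriv (l : ℝ) (u w : ℝ → ℂ) : Prop :=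
  MemLp w 2 (volume.restrict (Icc 0 l)) ∧
    ∃ v : ℝ → ℂ, (∀ x ∈ Icc 0 l, v x = v 0 + ∫ t in (0 : ℝ)..x, w t) ∧
      ∀ x ∈ Icc 0 l, u x = u 0 + ∫ t in (0 : ℝ)..x, v t

/-- The derivative of `f` at the end `h = (e, b)` of the edge `e`, in the direction from that end
into the edge. -/
noncomputable def outDeriv (Γ : MetricGraph V E) (f : Γ.Pt → ℂ) (h : E × Bool) : ℂ :=
  match h with
  | (e, false) => derivWithin (Γ.onEdge f e) (Icc 0 (Γ.len e)) 0
  | (e, true) => -derivWithin (Γ.onEdge f e) (Icc 0 (Γ.len e)) (Γ.len e)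

open Classical in
/-- `f` is an eigenfunction with eigenvalue `lam` of the Laplacian `-d²/dx²` on `Γ` with Neumann
(Kirchhoff) vertex conditions. -/
structure IsEigenfunction [Fintype E] (Γ : MetricGraph V E) (lam : ℝ) (f : Γ.Pt → ℂ) : Prop where
  ne_zero : f ≠ 0
  continuous : Continuous f
  laplace : ∀ e, ∃ w : ℝ → ℂ, HasSecondDeriv (Γ.len e) (Γ.onEdge f e) w ∧
    ∀ᵐ x ∂(volume.restrict (Icc 0 (Γ.len e))), -w x = (lam : ℂ) * Γ.onEdge f e x
  kirchhoff : ∀ v, ∑ h ∈ Finset.univ.filter (fun h : E × Bool => Γ.endpt h.1 h.2 = v),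
    Γ.outDeriv f h = 0

/-- `f` is a generic eigenfunction with eigenvalue `lam`: the eigenvalue is simple, `f` does not
vanish at vertices, and no outgoing derivative of `f` vanishes at a vertex that is not of degree
one. -/
structure IsGenericEigenfunction [Fintype E] (Γ : MetricGraph V E) (lam : ℝ) (f : Γ.Pt → ℂ) :
    Prop where
  eigen : Γ.IsEigenfunction lam f
  simple : ∀ g, Γ.IsEigenfunction lam g → ∃ c : ℂ, g = c • f
  ne_zero_vtx : ∀ v, f (Γ.vtx v) ≠ 0
  outDeriv_ne_zero : ∀ h : E × Bool, Γ.degree (Γ.endpt h.1 h.2) ≠ 1 → Γ.outDeriv f h ≠ 0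

/-- The nodal points of `f`: the zeros of `f` that are not vertices. -/
def nodalPoints (Γ : MetricGraph V E) (f : Γ.Pt → ℂ) : Set (Σ e : E, Ioo (0 : ℝ) (Γ.len e)) :=
  {q | f (Γ.innerPt q) = 0}

/-- The Neumann points of `f`: the zeros of `f'` that are not vertices. -/
def neumannPoints (Γ : MetricGraph V E) (f : Γ.Pt → ℂ) : Set (Σ e : E, Ioo (0 : ℝ) (Γ.len e)) :=
  {q | deriv (Γ.onEdge f q.1) q.2 = 0}

/-- A nodal domain of `f`: a connected component of `Γ` without the nodal points of `f`. -/
def IsNodalDomain (Γ : MetricGraph V E) (f : Γ.Pt → ℂ) (Ω : Set Γ.Pt) : Prop :=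
  ∃ p ∈ (Γ.innerPt '' Γ.nodalPoints f)ᶜ,
    Ω = connectedComponentIn (Γ.innerPt '' Γ.nodalPoints f)ᶜ p

/-- The Neumann points of `f|_Ω`, for a nodal domain `Ω`; their number is the Neumann count. -/
def neumannPointsIn (Γ : MetricGraph V E) (f : Γ.Pt → ℂ) (Ω : Set Γ.Pt) :
    Set (Σ e : E, Ioo (0 : ℝ) (Γ.len e)) :=
  {q | q ∈ Γ.neumannPoints f ∧ Γ.innerPt q ∈ Ω}

/-- The Neumann count `ξ(Ω) = ξ(f|_Ω)`. -/
noncomputable def neumannCount (Γ : MetricGraph V E) (f : Γ.Pt → ℂ) (Ω : Set Γ.Pt) : ℕ :=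
  (Γ.neumannPointsIn f Ω).ncard

/-- The boundary `∂Ω` of a nodal domain `Ω`, considered as a metric graph: its vertices of degree
one. These are the vertices of `Γ` of degree one that lie in `Ω`, and one new vertex for every
end of `Ω` at a nodal point, that is, for every nodal point `q` and side of `q` (`false`: left,
`true`: right) on which the points near `q` belong to `Ω`. -/
def boundary (Γ : MetricGraph V E) (f : Γ.Pt → ℂ) (Ω : Set Γ.Pt) :
    Set (V ⊕ ((Σ e : E, Ioo (0 : ℝ) (Γ.len e)) × Bool)) :=
  Sum.inl '' {v | Γ.degree v = 1 ∧ Γ.vtx v ∈ Ω} ∪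
  Sum.inr '' ({s | s.1 ∈ Γ.nodalPoints f ∧ s.2 = false ∧
      ∀ᶠ y in 𝓝[<] (s.1.2 : ℝ), Γ.pt s.1.1 y ∈ Ω} ∪
    {s | s.1 ∈ Γ.nodalPoints f ∧ s.2 = true ∧
      ∀ᶠ y in 𝓝[>] (s.1.2 : ℝ), Γ.pt s.1.1 y ∈ Ω})

/-- The total length `|Ω|` of a part `Ω` of `Γ`. -/
noncomputable def totalLen [Fintype E] (Γ : MetricGraph V E) (Ω : Set Γ.Pt) : ℝ :=
  ∑ e, volume.real {x : ℝ | x ∈ Ioo 0 (Γ.len e) ∧ Γ.pt e x ∈ Ω}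

/-- The wavelength capacity `ρ(Ω) = |Ω| k / π`. -/
noncomputable def wavelengthCapacity [Fintype E] (Γ : MetricGraph V E) (k : ℝ) (Ω : Set Γ.Pt) :
    ℝ :=
  Γ.totalLen Ω * k / Real.pi

end MetricGraph

/-! For each edge end `h`, let `t` be the distance from it. Simplicity of the eigenvalue makes `f` a
complex constant times a real function, and `f` does not vanish at vertices, so on the whole edge `f
= D h * sin (k * (l h - t))` with `0 < k * l h < π`. Since `k * len > π`, the first zero, at
distance `l h`, lies inside the edge. Hence no nodal domain contains two vertices: it is either a
star at a vertex `v`, with one arm of length `l h` for each end `h` at `v`, or a segment of length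
`π / k` between adjacent zeros of one edge. The segment has one Neumann point, two boundary points
and capacity one.

For the star put `x h = k * l h - π / 2`, an angle in `(-π/2, π/2)`. The outgoing derivative at `h`
is `f v * k * tan (x h)`, so the Kirchhoff condition says that the tangents sum to zero. An arm has
a Neumann point, and then only one, exactly when `x h > 0`, and `π ρ = ∑ x h + deg v * π / 2`. The
capacity bounds thus reduce to a statement on angles whose tangents sum to zero: with `p > 0` of
them positive, their sum is at most `(p - 1) * π / 2` (`Real.sum_le_of_sum_tan_eq_zero`). Applied to
`x` this is the upper bound with `p = ξ`. If `deg v ≠ 1`, genericity excludes `x h = 0`, both signs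
occur, and the same statement for `-x`, with `p = deg v - ξ`, is the lower bound. If `deg v = 1`,
the only angle is zero and the star is a quarter wave. -/

/-! ### Angles whose tangents sum to zero -/

/-- The tangent is superadditive on angles with sum less than `π/2`. -/
theorem Real.sum_tan_le_tan_sum {ι : Type*} (s : Finset ι) (x : ι → ℝ) (h0 : ∀ i ∈ s, 0 ≤ x i)
    (h1 : ∑ i ∈ s, x i < Real.pi / 2) : ∑ i ∈ s, Real.tan (x i) ≤ Real.tan (∑ i ∈ s, x i) := by
  classical
  induction s using Finset.induction_on with
  | empty => simp
  | insert a s ha ih =>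
    rw [Finset.sum_insert ha] at h1 ⊢
    rw [Finset.sum_insert ha]
    have hxa : 0 ≤ x a := h0 a (Finset.mem_insert_self _ _)
    have hs : ∀ i ∈ s, 0 ≤ x i := fun i hi => h0 i (Finset.mem_insert_of_mem hi)
    have hS : 0 ≤ ∑ i ∈ s, x i := Finset.sum_nonneg hs
    have ih' := ih hs (by linarith)
    set S := ∑ i ∈ s, x i
    have hpi := Real.pi_pos
    have hca : 0 < Real.cos (x a) := Real.cos_pos_of_mem_Ioo ⟨by linarith, by linarith⟩
    have hcS : 0 < Real.cos S := Real.cos_pos_of_mem_Ioo ⟨by linarith, by linarith⟩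
    have hc : 0 < Real.cos (x a + S) := Real.cos_pos_of_mem_Ioo ⟨by linarith, by linarith⟩
    have hsa : 0 ≤ Real.sin (x a) := Real.sin_nonneg_of_nonneg_of_le_pi hxa (by linarith)
    have hsS : 0 ≤ Real.sin S := Real.sin_nonneg_of_nonneg_of_le_pi hS (by linarith)
    have hsum : 0 ≤ Real.sin (x a + S) :=
      Real.sin_nonneg_of_nonneg_of_le_pi (by linarith) (by linarith)
    have h2 : Real.tan (x a) + Real.tan S = Real.sin (x a + S) / (Real.cos (x a) * Real.cos S) := by
      rw [Real.tan_eq_sin_div_cos, Real.tan_eq_sin_div_cos, Real.sin_add]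
      field_simp
    have h3 : Real.tan (x a) + Real.tan S ≤ Real.tan (x a + S) := by
      rw [h2, Real.tan_eq_sin_div_cos]
      refine div_le_div_of_nonneg_left hsum hc ?_
      rw [Real.cos_add]
      nlinarith [mul_nonneg hsa hsS]
    linarith

/-- If the tangents of finitely many angles in `(-π/2, π/2)` sum to zero, and not all angles are
nonpositive, then the sum of the angles is at most `π/2` times the number of positive angles less
one. -/
theorem Real.sum_le_of_sum_tan_eq_zero {ι : Type*} (s : Finset ι) (x : ι → ℝ)
    (h0 : ∀ i ∈ s, -(Real.pi / 2) < x i) (h1 : ∀ i ∈ s, x i < Real.pi / 2)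
    (hsum : ∑ i ∈ s, Real.tan (x i) = 0) (hpos : ∃ i ∈ s, 0 < x i) :
    ∑ i ∈ s, x i ≤ (((s.filter fun i => 0 < x i).card : ℝ) - 1) * (Real.pi / 2) := by
  classical
  obtain ⟨p, hps, hp⟩ := hpos
  set P := s.filter fun i => 0 < x i with hP
  set N := s.filter fun i => ¬ 0 < x i with hN
  have hpP : p ∈ P := Finset.mem_filter.2 ⟨hps, hp⟩
  have hx : ∑ i ∈ s, x i = ∑ i ∈ P, x i - ∑ i ∈ N, -x i := by
    rw [← Finset.sum_filter_add_sum_filter_not s (fun i => 0 < x i), Finset.sum_neg_distrib]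
    ring
  have ht : ∑ i ∈ P, Real.tan (x i) = ∑ i ∈ N, Real.tan (-x i) := by
    rw [← Finset.sum_filter_add_sum_filter_not s (fun i => 0 < x i)] at hsum
    simp_rw [Real.tan_neg, Finset.sum_neg_distrib]
    linarith
  have hmul : ∀ T : Finset ι, T ⊆ P → ∑ i ∈ T, x i ≤ (T.card : ℝ) * (Real.pi / 2) := by
    intro T hT
    rw [← nsmul_eq_mul]
    exact Finset.sum_le_card_nsmul _ _ _ fun i hi =>
      (h1 i (Finset.mem_filter.1 (hT hi)).1).le
  -- If the negative angles total at least `π / 2` in absolute value, they outweigh one positive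
  -- angle. Otherwise superadditivity applies to them and shows that they outweigh the positive
  -- angle `x p`. Either way at most `P.card - 1` angles, each below `π / 2`, remain.
  rcases le_or_gt (Real.pi / 2) (∑ i ∈ N, -x i) with hbig | hsmall
  · have := hmul P subset_rfl
    rw [hx]
    linarith
  · have hN0 : ∀ i ∈ N, 0 ≤ -x i := fun i hi => by
      have := (Finset.mem_filter.1 hi).2
      linarith
    have h2 : Real.tan (x p) ≤ ∑ i ∈ P, Real.tan (x i) := by
      refine Finset.single_le_sum (f := fun i => Real.tan (x i)) (fun i hi => ?_) hpP
      have := Finset.mem_filter.1 hi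
      exact (Real.tan_pos_of_pos_of_lt_pi_div_two this.2 (h1 i this.1)).le
    have h3 : Real.tan (x p) ≤ Real.tan (∑ i ∈ N, -x i) :=
      h2.trans (ht.trans_le (Real.sum_tan_le_tan_sum N _ hN0 hsmall))
    have hS0 := Finset.sum_nonneg hN0
    have hpi := Real.pi_pos
    have h4 : x p ≤ ∑ i ∈ N, -x i :=
      (Real.strictMonoOn_tan.le_iff_le ⟨h0 p hps, h1 p hps⟩ ⟨by linarith, hsmall⟩).1 h3
    have h5 := hmul (P.erase p) (Finset.erase_subset _ _)
    have h6 := Finset.add_sum_erase P x hpP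
    have h7 : ((P.erase p).card : ℝ) + 1 = P.card := by
      exact_mod_cast Finset.card_erase_add_one hpP
    rw [hx, ← h7]
    linarith

/-- Otherwise every tangent would be negative. Used for `x` and for `-x`, so that both signs occur
at a vertex of degree other than one. -/
theorem Real.exists_pos_of_sum_tan_eq_zero {ι : Type*} (s : Finset ι) (hs : s.Nonempty)
    (x : ι → ℝ) (h0 : ∀ i ∈ s, -(Real.pi / 2) < x i) (hne : ∀ i ∈ s, x i ≠ 0)
    (hsum : ∑ i ∈ s, Real.tan (x i) = 0) : ∃ i ∈ s, 0 < x i := by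
  by_contra! h
  have : ∑ i ∈ s, Real.tan (x i) < 0 := Finset.sum_neg (fun i hi =>
    Real.tan_neg_of_neg_of_pi_div_two_lt ((h i hi).lt_of_ne (hne i hi)) (h0 i hi)) hs
  exact this.ne hsum

/-! ### Auxiliary facts from topology and trigonometry -/

/-- An open preconnected subset of `S` whose relative complement is open is a component of `S`. -/
theorem IsPreconnected.connectedComponentIn_eq_of_isOpen {X : Type*} [TopologicalSpace X]
    {S T : Set X} {p : X} (hT : IsPreconnected T) (hTS : T ⊆ S) (hp : p ∈ T) (ho : IsOpen T)
    (hc : IsOpen (S \ T)) : _root_.connectedComponentIn S p = T := by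
  apply Subset.antisymm
  · refine IsPreconnected.subset_left_of_subset_union ho hc disjoint_sdiff_right ?_
      ⟨p, mem_connectedComponentIn (hTS hp), hp⟩ isPreconnected_connectedComponentIn
    rw [union_sdiff_cancel hTS]
    exact connectedComponentIn_subset S p
  · exact hT.subset_connectedComponentIn hp hTS

theorem Real.eq_pi_div_two_of_cos_eq_zero {y : ℝ} (h0 : 0 < y) (h1 : y < Real.pi)
    (h : Real.cos y = 0) : y = Real.pi / 2 :=
  Real.injOn_cos ⟨h0.le, h1.le⟩ ⟨by positivity, by linarith⟩ (h.trans Real.cos_pi_div_two.symm)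

/-- Reversing an edge exchanges the two sides of a point; this allows both kinds of boundary point
to be described by approach from the end `h`. -/
theorem eventually_nhdsLT_sub_iff {c t : ℝ} {p : ℝ → Prop} :
    (∀ᶠ s in 𝓝[<] t, p (c - s)) ↔ ∀ᶠ y in 𝓝[>] (c - t), p y := by
  have key : ∀ (u : ℝ), Tendsto (fun s => c - s) (𝓝[<] u) (𝓝[>] (c - u)) := fun u =>
    tendsto_nhdsWithin_iff.2 ⟨((continuous_sub_left c).tendsto u).mono_left nhdsWithin_le_nhds,
      eventually_mem_nhdsWithin.mono fun s (hs : s < u) => sub_lt_sub_left hs c⟩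
  have key' : ∀ (u : ℝ), Tendsto (fun s => c - s) (𝓝[>] u) (𝓝[<] (c - u)) := fun u =>
    tendsto_nhdsWithin_iff.2 ⟨((continuous_sub_left c).tendsto u).mono_left nhdsWithin_le_nhds,
      eventually_mem_nhdsWithin.mono fun s (hs : u < s) => sub_lt_sub_left hs c⟩
  constructor
  · intro h
    have := key' (c - t)
    rw [sub_sub_cancel] at this
    exact (this.eventually h).mono fun y hy => by rwa [sub_sub_cancel] at hy
  · exact fun h => (key t).eventually h

/-- The phase is `arctan (b / a) + π / 2`. The condition `a ≠ 0` keeps it strictly between `0` and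
`π`; the sign of `a` is absorbed in `D`. -/
theorem Real.exists_phase {a : ℝ} (ha : a ≠ 0) (b : ℝ) :
    ∃ D φ : ℝ, D ≠ 0 ∧ 0 < φ ∧ φ < Real.pi ∧
      ∀ s, a * Real.cos s + b * Real.sin s = D * Real.sin (φ - s) := by
  have hc := Real.cos_arctan_pos (b / a)
  refine ⟨a / Real.cos (Real.arctan (b / a)), Real.arctan (b / a) + Real.pi / 2,
    div_ne_zero ha hc.ne', by linarith [Real.neg_pi_div_two_lt_arctan (b / a)],
    by linarith [Real.arctan_lt_pi_div_two (b / a)], fun s => ?_⟩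
  have h1 : Real.sin (Real.arctan (b / a) + Real.pi / 2 - s)
      = Real.cos (Real.arctan (b / a) - s) := by
    rw [← Real.sin_add_pi_div_two]; ring_nf
  have h2 : Real.sin (Real.arctan (b / a)) = b / a * Real.cos (Real.arctan (b / a)) := by
    rw [← Real.tan_mul_cos hc.ne', Real.tan_arctan]
  rw [h1, Real.cos_sub, h2]
  field_simp

/-! ### The eigenvalue equation on an edge -/

namespace MetricGraph

variable {V E : Type*}

/-- A solution of `-u'' = k² u` on `[0, l]` in the Sobolev sense is a trigonometric function. -/
theorem HasSecondDeriv.eq_trig {l k : ℝ} (hk : 0 < k) {u w : ℝ → ℂ} (hc : Continuous u)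
    (hu : HasSecondDeriv l u w)
    (hw : ∀ᵐ x ∂(volume.restrict (Icc 0 l)), -w x = ((k ^ 2 : ℝ) : ℂ) * u x) :
    ∃ b : ℂ, ∀ x ∈ Icc 0 l, u x = u 0 * (Real.cos (k * x) : ℂ) + b * (Real.sin (k * x) : ℂ) := by
  obtain ⟨-, v, hv, huv⟩ := hu
  -- The weak second derivative agrees almost everywhere with the continuous function `-k² u`, so it
  -- may be replaced by it under the integral; then `u` and `v` agree on `[0, l]` with functions
  -- differentiable in the classical sense.
  set r : ℝ → ℂ := fun x => -(((k ^ 2 : ℝ) : ℂ) * u x) with hr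
  have hrc : Continuous r := by fun_prop
  set v₁ : ℝ → ℂ := fun x => v 0 + ∫ t in (0 : ℝ)..x, r t with hv₁
  have hdv : ∀ x, HasDerivAt v₁ (r x) x := fun x =>
    ((hrc.integral_hasStrictDerivAt 0 x).hasDerivAt).const_add _
  have hvc : Continuous v₁ := continuous_iff_continuousAt.2 fun x => (hdv x).continuousAt
  have hvv : ∀ x ∈ Icc 0 l, v x = v₁ x := by
    intro x hx
    rw [hv x hx, hv₁]
    congr 1
    apply intervalIntegral.integral_congr_ae_restrict
    have hsub : uIoc 0 x ⊆ Icc 0 l := by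
      rw [uIoc_of_le hx.1]
      exact fun y hy => ⟨hy.1.le, hy.2.trans hx.2⟩
    filter_upwards [ae_restrict_of_ae_restrict_of_subset hsub hw] with y hy
    simp only [hr, ← hy, neg_neg]
  set u₁ : ℝ → ℂ := fun x => u 0 + ∫ t in (0 : ℝ)..x, v₁ t with hu₁
  have hdu : ∀ x, HasDerivAt u₁ (v₁ x) x := fun x =>
    ((hvc.integral_hasStrictDerivAt 0 x).hasDerivAt).const_add _
  have huu : ∀ x ∈ Icc 0 l, u x = u₁ x := by
    intro x hx
    rw [huv x hx, hu₁]
    congr 1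
    apply intervalIntegral.integral_congr
    intro y hy
    rw [uIcc_of_le hx.1] at hy
    exact hvv y ⟨hy.1, hy.2.trans hx.2⟩
  have hk' : (k : ℂ) ≠ 0 := by exact_mod_cast hk.ne'
  have hcos : ∀ x, HasDerivAt (fun x : ℝ => (Real.cos (k * x) : ℂ))
      ((-Real.sin (k * x) * k : ℝ) : ℂ) x := fun x => by
    have := ((hasDerivAt_id x).const_mul k).cos
    simpa using this.ofReal_comp
  have hsin : ∀ x, HasDerivAt (fun x : ℝ => (Real.sin (k * x) : ℂ))
      ((Real.cos (k * x) * k : ℝ) : ℂ) x := fun x => by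
    have := ((hasDerivAt_id x).const_mul k).sin
    simpa using this.ofReal_comp
  -- Rotating the vector `(u, v / k)` by the angle `k * x` gives constants of the motion; `hP` and
  -- `hQ` are its two components, and rotating back solves for `u`.
  have hP : ∀ x ∈ Icc 0 l, u₁ x * (Real.cos (k * x) : ℂ) - v₁ x / k * (Real.sin (k * x) : ℂ)
      = u 0 := by
    intro x hx
    have := constant_of_has_deriv_right_zero (a := 0) (b := l)
      (f := fun x : ℝ => u₁ x * (Real.cos (k * x) : ℂ) - v₁ x / k * (Real.sin (k * x) : ℂ))
      (fun y _ => (((hdu y).mul (hcos y)).sub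
        (((hdv y).div_const _).mul (hsin y))).continuousAt.continuousWithinAt)
      (fun y hy => by
        refine ((((hdu y).mul (hcos y)).sub
          (((hdv y).div_const _).mul (hsin y))).congr_deriv ?_).hasDerivWithinAt
        rw [hr, ← huu y ⟨hy.1, hy.2.le⟩]
        push_cast
        field_simp
        ring) x hx
    simpa [hu₁] using this
  have hQ : ∀ x ∈ Icc 0 l, u₁ x * (Real.sin (k * x) : ℂ) + v₁ x / k * (Real.cos (k * x) : ℂ)
      = v 0 / k := by
    intro x hx
    have := constant_of_has_deriv_right_zero (a := 0) (b := l)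
      (f := fun x : ℝ => u₁ x * (Real.sin (k * x) : ℂ) + v₁ x / k * (Real.cos (k * x) : ℂ))
      (fun y _ => (((hdu y).mul (hsin y)).add
        (((hdv y).div_const _).mul (hcos y))).continuousAt.continuousWithinAt)
      (fun y hy => by
        refine ((((hdu y).mul (hsin y)).add
          (((hdv y).div_const _).mul (hcos y))).congr_deriv ?_).hasDerivWithinAt
        rw [hr, ← huu y ⟨hy.1, hy.2.le⟩]
        push_cast
        field_simp
        ring) x hx
    simpa [hv₁] using this
  refine ⟨v 0 / k, fun x hx => ?_⟩
  have h1 : (Real.sin (k * x) : ℂ) ^ 2 + (Real.cos (k * x) : ℂ) ^ 2 = 1 := by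
    exact_mod_cast Real.sin_sq_add_cos_sq (k * x)
  rw [huu x hx]
  linear_combination (-u₁ x) * h1 + (Real.cos (k * x) : ℂ) * hP x hx
    + (Real.sin (k * x) : ℂ) * hQ x hx

/-! ### Edge parametrizations and the topology of the graph -/

theorem pt_zero (Γ : MetricGraph V E) (e : E) : Γ.pt e 0 = Γ.vtx (Γ.endpt e false) := by
  simp [pt]

theorem pt_len (Γ : MetricGraph V E) (e : E) : Γ.pt e (Γ.len e) = Γ.vtx (Γ.endpt e true) := by
  simp [pt, (Γ.len_pos e).not_ge]

theorem pt_of_mem (Γ : MetricGraph V E) {e : E} {x : ℝ} (hx : x ∈ Ioo 0 (Γ.len e)) :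
    Γ.pt e x = Γ.innerPt ⟨e, x, hx⟩ := by
  simp [pt, hx.1.not_ge, hx.2.not_ge]

theorem continuous_pt (Γ : MetricGraph V E) (e : E) : Continuous (Γ.pt e) := by
  have h : Γ.pt e = (fun q : (Σ e : E, Icc (0 : ℝ) (Γ.len e)) => Γ.pt q.1 q.2) ∘
      (fun y : Icc (0 : ℝ) (Γ.len e) => ⟨e, y⟩) ∘ projIcc 0 (Γ.len e) (Γ.len_pos e).le := by
    funext x
    simp only [Function.comp]
    rcases le_total x 0 with h0 | h0
    · rw [projIcc_of_le_left _ h0, pt_zero]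
      simp [pt, h0]
    rcases le_total (Γ.len e) x with h1 | h1
    · rw [projIcc_of_right_le _ h1, pt_len]
      simp [pt, h1, ((Γ.len_pos e).trans_le h1).not_ge]
    · rw [projIcc_of_mem _ ⟨h0, h1⟩]
  rw [h]
  exact continuous_coinduced_rng.comp (continuous_sigmaMk.comp continuous_projIcc)

/-- A set is open if its preimage in every edge is. -/
theorem isOpen_of_edges (Γ : MetricGraph V E) {S : Set Γ.Pt} (U : E → Set ℝ)
    (hU : ∀ e, IsOpen (U e)) (h : ∀ e, ∀ x ∈ Icc 0 (Γ.len e), Γ.pt e x ∈ S ↔ x ∈ U e) :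
    IsOpen S := by
  apply isOpen_coinduced.2
  rw [isOpen_sigma_iff]
  intro e
  convert (hU e).preimage (continuous_subtype_val (p := fun x => x ∈ Icc 0 (Γ.len e))) using 1
  ext x
  exact h e x x.2

/-- Every vertex of a standard graph is the end point of an edge. -/
theorem IsStandard.exists_endpt {Γ : MetricGraph V E} (hΓ : Γ.IsStandard) (v : V) :
    ∃ h : E × Bool, Γ.endpt h.1 h.2 = v := by
  by_contra! hv
  have key : ∀ e, ∀ x ∈ Icc 0 (Γ.len e), Γ.pt e x ≠ Γ.vtx v := by
    intro e x hx hxv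
    rcases hx.1.eq_or_lt with h0 | h0
    · rw [← h0, pt_zero] at hxv
      exact hv (e, false) (Sum.inl_injective hxv)
    rcases hx.2.eq_or_lt with h1 | h1
    · rw [h1, pt_len] at hxv
      exact hv (e, true) (Sum.inl_injective hxv)
    · rw [pt_of_mem Γ ⟨h0, h1⟩] at hxv
      exact Sum.inr_ne_inl hxv
  -- A vertex on no edge would be an open and closed point, hence the whole connected space,
  -- although there is an edge.
  have hopen : IsOpen ({Γ.vtx v} : Set Γ.Pt) :=
    Γ.isOpen_of_edges (fun _ => ∅) (fun _ => isOpen_empty) fun e x hx => by simpa using key e x hx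
  have hclosed : IsClosed ({Γ.vtx v} : Set Γ.Pt) := ⟨
    Γ.isOpen_of_edges (fun _ => univ) (fun _ => isOpen_univ) fun e x hx => by simpa using key e x hx⟩
  have := hΓ.connected
  have huniv := IsClopen.eq_univ ⟨hclosed, hopen⟩ (singleton_nonempty (Γ.vtx v))
  obtain ⟨e⟩ := hΓ.nonempty_edges
  have hl := Γ.len_pos e
  have : Γ.pt e 0 ∈ ({Γ.vtx v} : Set Γ.Pt) := huniv ▸ mem_univ _
  exact key e 0 ⟨le_rfl, hl.le⟩ this

/-! ### Reality of generic eigenfunctions -/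

theorem HasSecondDeriv.conj {l : ℝ} {u w : ℝ → ℂ} (h : HasSecondDeriv l u w) :
    HasSecondDeriv l (fun x => starRingEnd ℂ (u x)) (fun x => starRingEnd ℂ (w x)) := by
  obtain ⟨hw, v, hv, hu⟩ := h
  refine ⟨hw.star, fun x => starRingEnd ℂ (v x), fun x hx => ?_, fun x hx => ?_⟩
  · simp only [intervalIntegral.intervalIntegral_conj, hv x hx, map_add]
  · simp only [intervalIntegral.intervalIntegral_conj, hu x hx, map_add]

theorem IsEigenfunction.conj [Fintype E] {Γ : MetricGraph V E} {lam : ℝ} {f : Γ.Pt → ℂ}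
    (hf : Γ.IsEigenfunction lam f) : Γ.IsEigenfunction lam (fun p => starRingEnd ℂ (f p)) where
  ne_zero h := hf.ne_zero <| funext fun p => by simpa using congrFun h p
  continuous := Complex.continuous_conj.comp hf.continuous
  laplace e := by
    obtain ⟨w, hw, hlam⟩ := hf.laplace e
    refine ⟨_, hw.conj, ?_⟩
    filter_upwards [hlam] with x hx
    rw [← map_neg, hx, map_mul, Complex.conj_ofReal]
    rfl
  kirchhoff v := by
    have h : ∀ h : E × Bool, Γ.outDeriv (fun p => starRingEnd ℂ (f p)) h
        = starRingEnd ℂ (Γ.outDeriv f h) := by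
      rintro ⟨e, _ | _⟩
      · exact derivWithin.star
      · exact (congrArg Neg.neg derivWithin.star).trans (map_neg (starRingEnd ℂ) _).symm
    simp_rw [h, ← map_sum, hf.kirchhoff v, map_zero]

/-- A generic eigenfunction is a multiple of a real function. -/
theorem IsGenericEigenfunction.exists_real [Fintype E] {Γ : MetricGraph V E} {lam : ℝ}
    {f : Γ.Pt → ℂ} (hf : Γ.IsGenericEigenfunction lam f) (v : V) :
    ∀ p, ∃ r : ℝ, f p = f (Γ.vtx v) * r := by
  obtain ⟨c, hc⟩ := hf.simple _ hf.eigen.conj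
  have hc' : ∀ p, starRingEnd ℂ (f p) = c * f p := fun p => congrFun hc p
  have hz := hf.ne_zero_vtx v
  intro p
  -- The conjugate of `f` is `c • f` by simplicity, and the factor `c` cancels in the quotient.
  have h : starRingEnd ℂ (f p / f (Γ.vtx v)) = f p / f (Γ.vtx v) := by
    rw [map_div₀, hc', hc']
    have : c ≠ 0 := by
      rintro rfl
      simpa [hz] using hc' (Γ.vtx v)
    field_simp
  obtain ⟨r, hr⟩ := Complex.conj_eq_iff_real.1 h
  exact ⟨r, by rw [← hr]; field_simp⟩

/-! ### The sine profile seen from each edge end -/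

/-- The coordinate on the edge `h.1` of the point at distance `t` from the end `h`. -/
def pos (Γ : MetricGraph V E) (h : E × Bool) (t : ℝ) : ℝ := cond h.2 (Γ.len h.1 - t) t

@[simp] theorem pos_false (Γ : MetricGraph V E) (e : E) (t : ℝ) : Γ.pos (e, false) t = t := rfl

@[simp] theorem pos_true (Γ : MetricGraph V E) (e : E) (t : ℝ) :
    Γ.pos (e, true) t = Γ.len e - t := rfl

@[simp] theorem pos_pos (Γ : MetricGraph V E) (h : E × Bool) (t : ℝ) :
    Γ.pos h (Γ.pos h t) = t := by
  rcases h with ⟨e, _ | _⟩ <;> simp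

theorem pos_mem_Icc (Γ : MetricGraph V E) {h : E × Bool} {t : ℝ} (ht : t ∈ Icc 0 (Γ.len h.1)) :
    Γ.pos h t ∈ Icc 0 (Γ.len h.1) := by
  rcases h with ⟨e, _ | _⟩
  · exact ht
  · exact ⟨sub_nonneg.2 ht.2, sub_le_self _ ht.1⟩

theorem pos_mem_Ioo (Γ : MetricGraph V E) {h : E × Bool} {t : ℝ} (ht : t ∈ Ioo 0 (Γ.len h.1)) :
    Γ.pos h t ∈ Ioo 0 (Γ.len h.1) := by
  rcases h with ⟨e, _ | _⟩
  · exact ht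
  · exact ⟨sub_pos.2 ht.2, sub_lt_self _ ht.1⟩

theorem pos_not (Γ : MetricGraph V E) (h : E × Bool) (t : ℝ) :
    Γ.pos (h.1, !h.2) t = Γ.pos h (Γ.len h.1 - t) := by
  rcases h with ⟨e, _ | _⟩ <;> simp

theorem pt_pos_zero (Γ : MetricGraph V E) (h : E × Bool) :
    Γ.pt h.1 (Γ.pos h 0) = Γ.vtx (Γ.endpt h.1 h.2) := by
  rcases h with ⟨e, _ | _⟩
  · exact Γ.pt_zero e
  · simpa using Γ.pt_len e

theorem continuous_pos (Γ : MetricGraph V E) (h : E × Bool) : Continuous (Γ.pos h) := by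
  rcases h with ⟨e, _ | _⟩
  · exact continuous_id
  · exact continuous_const.sub continuous_id

/-- The function `f` near each end `h` of an edge: with `t` the distance to `h`, it is
`D h * sin (k * (l h - t))` on the edge, where `l h` is the distance from `h` to the first zero. -/
structure Profile (Γ : MetricGraph V E) (k : ℝ) (f : Γ.Pt → ℂ) (l : E × Bool → ℝ)
    (D : E × Bool → ℂ) : Prop where
  k_pos : 0 < k
  dist_pos : ∀ h, 0 < l h
  lt_pi : ∀ h, k * l h < Real.pi
  lt_len : ∀ h, l h < Γ.len h.1
  amp_ne_zero : ∀ h, D h ≠ 0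
  ne_zero_vtx : ∀ v, f (Γ.vtx v) ≠ 0
  formula : ∀ h, ∀ t ∈ Icc 0 (Γ.len h.1),
    f (Γ.pt h.1 (Γ.pos h t)) = D h * (Real.sin (k * (l h - t)) : ℝ)

theorem IsStandard.pi_lt {Γ : MetricGraph V E} [Finite E] (hΓ : Γ.IsStandard) {k : ℝ}
    (hk : Real.pi / Γ.minLen < k) : 0 < k ∧ ∀ e, Real.pi < k * Γ.len e := by
  have := hΓ.nonempty_edges
  obtain ⟨e₀, he₀⟩ := exists_eq_ciInf_of_finite (f := Γ.len)
  have hm : 0 < Γ.minLen := by rw [minLen, ← he₀]; exact Γ.len_pos _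
  have hk0 : 0 < k := (div_pos Real.pi_pos hm).trans hk
  refine ⟨hk0, fun e => ((div_lt_iff₀ hm).1 hk).trans_le ?_⟩
  exact mul_le_mul_of_nonneg_left (ciInf_le (finite_range _).bddBelow e) hk0.le

/-- The phase `φ h` lies in `(0, π)` because `f` does not vanish at the vertex, and `l h = φ h / k`.
The hypothesis on `k` enters through `φ h < π < k * len`, which places the first zero inside the
edge. -/
theorem exists_profile [Fintype E] {Γ : MetricGraph V E} (hΓ : Γ.IsStandard) {k : ℝ}
    (hk : Real.pi / Γ.minLen < k) {f : Γ.Pt → ℂ} (hf : Γ.IsGenericEigenfunction (k ^ 2) f) :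
    ∃ l D, Γ.Profile k f l D := by
  obtain ⟨hk0, hlen⟩ := hΓ.pi_lt hk
  obtain ⟨e₀⟩ := hΓ.nonempty_edges
  set z := f (Γ.vtx (Γ.endpt e₀ false)) with hz
  have hz0 : z ≠ 0 := hf.ne_zero_vtx _
  have hreal : ∀ p, ∃ r : ℝ, f p = z * r := hf.exists_real _
  have hedge : ∀ e, ∃ a b : ℝ, ∀ x ∈ Icc 0 (Γ.len e),
      f (Γ.pt e x) = z * ((a * Real.cos (k * x) + b * Real.sin (k * x) : ℝ) : ℂ) := by
    intro e
    obtain ⟨w, hw, hlam⟩ := hf.eigen.laplace e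
    obtain ⟨b, hb⟩ := hw.eq_trig (u := Γ.onEdge f e) hk0
      (hf.eigen.continuous.comp (Γ.continuous_pt e)) hlam
    -- After division by `z` the function is real, so taking real parts of the coefficients does not
    -- change it.
    refine ⟨(Γ.onEdge f e 0 / z).re, (b / z).re, fun x hx => ?_⟩
    obtain ⟨r, hr⟩ := hreal (Γ.pt e x)
    have h1 : (r : ℂ) = Γ.onEdge f e 0 / z * (Real.cos (k * x) : ℂ)
        + b / z * (Real.sin (k * x) : ℂ) := by
      have := hb x hx
      rw [show Γ.onEdge f e x = z * r from hr] at this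
      field_simp
      linear_combination this
    have h2 := congrArg Complex.re h1
    rw [Complex.add_re, Complex.re_mul_ofReal, Complex.re_mul_ofReal, Complex.ofReal_re] at h2
    rw [hr, h2]
  have hend : ∀ h : E × Bool, ∃ a b : ℝ, ∀ t ∈ Icc 0 (Γ.len h.1),
      f (Γ.pt h.1 (Γ.pos h t)) = z * ((a * Real.cos (k * t) + b * Real.sin (k * t) : ℝ) : ℂ) := by
    rintro ⟨e, _ | _⟩
    · exact hedge e
    · obtain ⟨a, b, hab⟩ := hedge e
      refine ⟨a * Real.cos (k * Γ.len e) + b * Real.sin (k * Γ.len e),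
        a * Real.sin (k * Γ.len e) - b * Real.cos (k * Γ.len e), fun t ht => ?_⟩
      rw [hab _ (Γ.pos_mem_Icc ht), pos_true, mul_sub, Real.cos_sub, Real.sin_sub]
      congr 2
      ring
  have hprof : ∀ h : E × Bool, ∃ (D : ℂ) (φ : ℝ), D ≠ 0 ∧ 0 < φ ∧ φ < Real.pi ∧
      ∀ t ∈ Icc 0 (Γ.len h.1),
        f (Γ.pt h.1 (Γ.pos h t)) = D * (Real.sin (φ - k * t) : ℝ) := by
    intro h
    obtain ⟨a, b, hab⟩ := hend h
    have ha : a ≠ 0 := by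
      rintro rfl
      have := hab 0 ⟨le_rfl, (Γ.len_pos _).le⟩
      rw [pt_pos_zero] at this
      exact hf.ne_zero_vtx _ (by simpa using this)
    obtain ⟨D, φ, hD, h0, h1, hs⟩ := Real.exists_phase ha b
    refine ⟨z * D, φ, mul_ne_zero hz0 (by exact_mod_cast hD), h0, h1, fun t ht => ?_⟩
    rw [hab t ht, hs]
    push_cast
    ring
  choose D φ hD h0 h1 hs using hprof
  have hkl : ∀ h, k * (φ h / k) = φ h := fun h => by field_simp
  refine ⟨fun h => φ h / k, D, hk0, fun h => div_pos (h0 h) hk0, fun h => by rw [hkl]; exact h1 h,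
    fun h => ?_, hD, hf.ne_zero_vtx, fun h t ht => ?_⟩
  · rw [div_lt_iff₀ hk0, mul_comm]
    exact (h1 h).trans (hlen _)
  · rw [hs h t ht, mul_sub, hkl]

theorem derivWithin_onEdge (Γ : MetricGraph V E) {f : Γ.Pt → ℂ} {e : E} {D : ℂ} {α β : ℝ}
    (h : ∀ x ∈ Icc 0 (Γ.len e), f (Γ.pt e x) = D * (Real.sin (α * x + β) : ℝ)) {x : ℝ}
    (hx : x ∈ Icc 0 (Γ.len e)) :
    derivWithin (Γ.onEdge f e) (Icc 0 (Γ.len e)) x = D * (Real.cos (α * x + β) * α : ℝ) := by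
  have h1 : HasDerivAt (fun x : ℝ => D * ((Real.sin (α * x + β) : ℝ) : ℂ))
      (D * (Real.cos (α * x + β) * α : ℝ)) x := by
    have := ((((hasDerivAt_id x).const_mul α).add_const β).sin).ofReal_comp.const_mul D
    simpa using this
  exact (h1.hasDerivWithinAt.congr h (h x hx)).derivWithin (uniqueDiffOn_Icc (Γ.len_pos e) x hx)

theorem deriv_onEdge (Γ : MetricGraph V E) {f : Γ.Pt → ℂ} {e : E} {D : ℂ} {α β : ℝ}
    (h : ∀ x ∈ Icc 0 (Γ.len e), f (Γ.pt e x) = D * (Real.sin (α * x + β) : ℝ)) {x : ℝ}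
    (hx : x ∈ Ioo 0 (Γ.len e)) :
    deriv (Γ.onEdge f e) x = D * (Real.cos (α * x + β) * α : ℝ) := by
  rw [← derivWithin_of_mem_nhds (Icc_mem_nhds hx.1 hx.2)]
  exact Γ.derivWithin_onEdge h ⟨hx.1.le, hx.2.le⟩

namespace Profile

variable {Γ : MetricGraph V E} {k : ℝ} {f : Γ.Pt → ℂ} {l : E × Bool → ℝ} {D : E × Bool → ℂ}

theorem formula_false (P : Γ.Profile k f l D) (e : E) : ∀ x ∈ Icc 0 (Γ.len e),
    f (Γ.pt e x) = D (e, false) * (Real.sin (-k * x + k * l (e, false)) : ℝ) := by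
  intro x hx
  have := P.formula (e, false) x hx
  rw [pos_false] at this
  rw [this]
  congr 3
  ring

theorem formula_true (P : Γ.Profile k f l D) (e : E) : ∀ x ∈ Icc 0 (Γ.len e),
    f (Γ.pt e x) = D (e, true) * (Real.sin (k * x + k * (l (e, true) - Γ.len e)) : ℝ) := by
  intro x hx
  have := P.formula (e, true) (Γ.len e - x) ⟨by linarith [hx.2], by linarith [hx.1]⟩
  rw [pos_true, sub_sub_cancel] at this
  rw [this]
  congr 3
  ring

/-- The logarithmic derivative at the end is `-k * cot (k * l h)`, written as a tangent. The factor
`f v * k` is common to all ends at `v` and cancels from the Kirchhoff condition. -/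
theorem outDeriv_eq (P : Γ.Profile k f l D) (h : E × Bool) :
    Γ.outDeriv f h = f (Γ.vtx (Γ.endpt h.1 h.2)) * k *
      (Real.tan (k * l h - Real.pi / 2) : ℝ) := by
  have hs : 0 < Real.sin (k * l h) :=
    Real.sin_pos_of_pos_of_lt_pi (mul_pos P.k_pos (P.dist_pos h)) (P.lt_pi h)
  have hv : f (Γ.vtx (Γ.endpt h.1 h.2)) = D h * (Real.sin (k * l h) : ℝ) := by
    rw [← pt_pos_zero, P.formula h 0 ⟨le_rfl, (Γ.len_pos _).le⟩, sub_zero]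
  have ht : Real.tan (k * l h - Real.pi / 2) = -Real.cos (k * l h) / Real.sin (k * l h) := by
    rw [Real.tan_eq_sin_div_cos, Real.sin_sub_pi_div_two, Real.cos_sub_pi_div_two]
  have hs' : ((Real.sin (k * l h) : ℝ) : ℂ) ≠ 0 := by exact_mod_cast hs.ne'
  have hd : Γ.outDeriv f h = D h * (-Real.cos (k * l h) * k : ℝ) := by
    rcases h with ⟨e, _ | _⟩
    · simp only [outDeriv]
      rw [Γ.derivWithin_onEdge (P.formula_false e) ⟨le_rfl, (Γ.len_pos e).le⟩]
      simp
    · simp only [outDeriv]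
      rw [Γ.derivWithin_onEdge (P.formula_true e) ⟨(Γ.len_pos e).le, le_rfl⟩]
      rw [show k * Γ.len e + k * (l (e, true) - Γ.len e) = k * l (e, true) by ring]
      push_cast
      ring
  rw [hd, hv, ht]
  push_cast
  push_cast at hs'
  field_simp

theorem deriv_eq_zero_iff (P : Γ.Profile k f l D) {h : E × Bool} {t : ℝ}
    (ht : t ∈ Ioo 0 (Γ.len h.1)) :
    deriv (Γ.onEdge f h.1) (Γ.pos h t) = 0 ↔ Real.cos (k * (l h - t)) = 0 := by
  have hk := P.k_pos.ne'
  have hp := Γ.pos_mem_Ioo ht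
  rcases h with ⟨e, _ | _⟩
  · rw [Γ.deriv_onEdge (P.formula_false e) hp, pos_false]
    rw [show -k * t + k * l (e, false) = k * (l (e, false) - t) by ring]
    simp [P.amp_ne_zero, hk, -Complex.ofReal_cos]
  · rw [Γ.deriv_onEdge (P.formula_true e) hp, pos_true]
    rw [show k * (Γ.len e - t) + k * (l (e, true) - Γ.len e) = k * (l (e, true) - t) by ring]
    simp [P.amp_ne_zero, hk, -Complex.ofReal_cos]

theorem eq_zero_iff (P : Γ.Profile k f l D) {h : E × Bool} {t : ℝ}
    (ht : t ∈ Icc 0 (Γ.len h.1)) :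
    f (Γ.pt h.1 (Γ.pos h t)) = 0 ↔ Real.sin (k * (l h - t)) = 0 := by
  rw [P.formula h t ht]
  simp [P.amp_ne_zero, -Complex.ofReal_sin]

theorem ne_zero_of_lt (P : Γ.Profile k f l D) {h : E × Bool} {t : ℝ} (h0 : 0 ≤ t)
    (ht : t < l h) : f (Γ.pt h.1 (Γ.pos h t)) ≠ 0 := by
  rw [Ne, P.eq_zero_iff ⟨h0, (ht.trans (P.lt_len h)).le⟩]
  have hk := P.k_pos
  refine (Real.sin_pos_of_pos_of_lt_pi (mul_pos hk (sub_pos.2 ht)) ?_).ne'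
  refine lt_of_le_of_lt ?_ (P.lt_pi h)
  exact mul_le_mul_of_nonneg_left (by linarith) hk.le

theorem eq_zero_at (P : Γ.Profile k f l D) (h : E × Bool) :
    f (Γ.pt h.1 (Γ.pos h (l h))) = 0 := by
  rw [P.eq_zero_iff ⟨(P.dist_pos h).le, (P.lt_len h).le⟩]
  simp

/-- The first zero from one end of an edge is not beyond the first zero from the other end. -/
theorem add_le_len (P : Γ.Profile k f l D) (h : E × Bool) :
    l h + l (h.1, !h.2) ≤ Γ.len h.1 := by
  by_contra! hlt
  have h1 := P.eq_zero_at (h.1, !h.2)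
  rw [pos_not] at h1
  exact P.ne_zero_of_lt (by linarith [P.lt_len (h.1, !h.2)]) (by linarith) h1

end Profile

/-! ### Nodal domains are stars or segments -/

/-- The points at distance less than `l h` from the end `h` of an edge at `v`, and `v` itself. -/
def starAt (Γ : MetricGraph V E) (l : E × Bool → ℝ) (v : V) : Set Γ.Pt :=
  {p | Sum.elim (fun u => u = v) (fun q : Σ e : E, Ioo (0 : ℝ) (Γ.len e) =>
    (Γ.endpt q.1 false = v ∧ (q.2 : ℝ) < l (q.1, false)) ∨
    (Γ.endpt q.1 true = v ∧ Γ.len q.1 - (q.2 : ℝ) < l (q.1, true))) p}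

/-- The points of the edge `e` with coordinate in `(a, b)`. -/
def segment (Γ : MetricGraph V E) (e : E) (a b : ℝ) : Set Γ.Pt :=
  {p | Sum.elim (fun _ => False) (fun q : Σ e : E, Ioo (0 : ℝ) (Γ.len e) =>
    q.1 = e ∧ (q.2 : ℝ) ∈ Ioo a b) p}

theorem vtx_mem_starAt (Γ : MetricGraph V E) {l : E × Bool → ℝ} {u v : V} :
    Γ.vtx u ∈ Γ.starAt l v ↔ u = v := Iff.rfl

theorem mem_Icc_cases (Γ : MetricGraph V E) {e : E} {x : ℝ} (hx : x ∈ Icc 0 (Γ.len e)) :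
    x = 0 ∨ x = Γ.len e ∨ x ∈ Ioo 0 (Γ.len e) := by
  rcases hx.1.eq_or_lt with h | h
  · exact Or.inl h.symm
  rcases hx.2.eq_or_lt with h' | h'
  · exact Or.inr (Or.inl h')
  · exact Or.inr (Or.inr ⟨h, h'⟩)

theorem pt_mem_segment (Γ : MetricGraph V E) {e e' : E} {a b x : ℝ} (ha : 0 ≤ a)
    (hb : b ≤ Γ.len e) (hx : x ∈ Icc 0 (Γ.len e')) :
    Γ.pt e' x ∈ Γ.segment e a b ↔ e' = e ∧ x ∈ Ioo a b := by
  rcases Γ.mem_Icc_cases hx with rfl | rfl | hx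
  · rw [pt_zero]
    exact ⟨False.elim, fun h => absurd h.2.1 ha.not_gt⟩
  · rw [pt_len]
    refine ⟨False.elim, ?_⟩
    rintro ⟨rfl, h⟩
    exact absurd h.2 hb.not_gt
  · rw [Γ.pt_of_mem hx]
    exact Iff.rfl

theorem isPreconnected_segment (Γ : MetricGraph V E) {e : E} {a b : ℝ} (ha : 0 ≤ a)
    (hb : b ≤ Γ.len e) : IsPreconnected (Γ.segment e a b) := by
  have h : Γ.segment e a b = Γ.pt e '' Ioo a b := by
    ext p
    constructor
    · rcases p with u | ⟨e', x, hx⟩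
      · exact False.elim
      · rintro ⟨he, hx'⟩
        obtain rfl : e' = e := he
        exact ⟨x, hx', Γ.pt_of_mem hx⟩
    · rintro ⟨x, hx, rfl⟩
      exact (Γ.pt_mem_segment ha hb ⟨ha.trans hx.1.le, hx.2.le.trans hb⟩).2 ⟨rfl, hx⟩
  rw [h]
  exact isPreconnected_Ioo.image _ (Γ.continuous_pt e).continuousOn

namespace Profile

variable {Γ : MetricGraph V E} {k : ℝ} {f : Γ.Pt → ℂ} {l : E × Bool → ℝ} {D : E × Bool → ℂ}

theorem compl_nodal (P : Γ.Profile k f l D) :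
    (Γ.innerPt '' Γ.nodalPoints f)ᶜ = {p | f p ≠ 0} := by
  ext p
  rcases p with v | q
  · refine ⟨fun _ => P.ne_zero_vtx v, fun _ => ?_⟩
    rintro ⟨q, -, hq⟩
    exact Sum.inr_ne_inl hq
  · constructor
    · intro h h0
      exact h ⟨q, h0, rfl⟩
    · rintro h ⟨q', hq', he⟩
      obtain rfl : q' = q := Sum.inr_injective he
      exact h hq'

theorem pt_mem_starAt (P : Γ.Profile k f l D) {v : V} {e : E} {x : ℝ}
    (hx : x ∈ Icc 0 (Γ.len e)) :
    Γ.pt e x ∈ Γ.starAt l v ↔ (Γ.endpt e false = v ∧ x < l (e, false)) ∨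
      (Γ.endpt e true = v ∧ Γ.len e - x < l (e, true)) := by
  have h0 := P.lt_len (e, false)
  have h1 := P.lt_len (e, true)
  have h2 := P.dist_pos (e, false)
  have h3 := P.dist_pos (e, true)
  simp only at h0 h1
  rcases Γ.mem_Icc_cases hx with rfl | rfl | hx
  · rw [pt_zero, vtx_mem_starAt, sub_zero]
    simp [h2, h1.le.not_gt]
  · rw [pt_len, vtx_mem_starAt, sub_self]
    simp [h3, h0.le.not_gt]
  · rw [Γ.pt_of_mem hx]
    exact Iff.rfl

theorem pt_pos_mem_starAt (P : Γ.Profile k f l D) {v : V} {h : E × Bool} {t : ℝ}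
    (ht : t ∈ Icc 0 (Γ.len h.1)) :
    Γ.pt h.1 (Γ.pos h t) ∈ Γ.starAt l v ↔ (Γ.endpt h.1 h.2 = v ∧ t < l h) ∨
      (Γ.endpt h.1 (!h.2) = v ∧ Γ.len h.1 - t < l (h.1, !h.2)) := by
  rw [P.pt_mem_starAt (Γ.pos_mem_Icc ht)]
  rcases h with ⟨e, _ | _⟩
  · simp
  · simp [or_comm]

theorem ne_zero_of_mem_starAt (P : Γ.Profile k f l D) {v : V} {p : Γ.Pt}
    (hp : p ∈ Γ.starAt l v) : f p ≠ 0 := by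
  rcases p with u | ⟨e, x, hx⟩
  · exact P.ne_zero_vtx u
  · have hpt : f (Γ.pt e x) = f (Sum.inr ⟨e, x, hx⟩) := by rw [Γ.pt_of_mem hx]; rfl
    rw [← hpt]
    rcases hp with ⟨-, h⟩ | ⟨-, h⟩
    · exact P.ne_zero_of_lt (h := (e, false)) hx.1.le h
    · have := P.ne_zero_of_lt (h := (e, true)) (sub_nonneg.2 hx.2.le) h
      simpa using this

theorem isPreconnected_starAt (P : Γ.Profile k f l D) (v : V) :
    IsPreconnected (Γ.starAt l v) := by
  have key : ∀ h : E × Bool, Γ.endpt h.1 h.2 = v → ∀ t ∈ Ico 0 (l h),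
      ∃ T ⊆ Γ.starAt l v, Γ.vtx v ∈ T ∧ Γ.pt h.1 (Γ.pos h t) ∈ T ∧ IsPreconnected T := by
    intro h hv t ht
    refine ⟨(fun t => Γ.pt h.1 (Γ.pos h t)) '' Ico 0 (l h), ?_, ⟨0, ⟨le_rfl, P.dist_pos h⟩, ?_⟩,
      ⟨t, ht, rfl⟩, isPreconnected_Ico.image _
        ((Γ.continuous_pt _).comp (Γ.continuous_pos h)).continuousOn⟩
    · rintro _ ⟨s, hs, rfl⟩
      exact (P.pt_pos_mem_starAt ⟨hs.1, (hs.2.trans (P.lt_len h)).le⟩).2 (Or.inl ⟨hv, hs.2⟩)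
    · rw [← hv]
      exact Γ.pt_pos_zero h
  apply isPreconnected_of_forall (Γ.vtx v)
  rintro (u | ⟨e, x, hx⟩) hp
  · obtain rfl : u = v := hp
    exact ⟨{Γ.vtx u}, singleton_subset_iff.2 rfl, rfl, rfl, isPreconnected_singleton⟩
  · have hpt : Γ.pt e x = Sum.inr ⟨e, x, hx⟩ := Γ.pt_of_mem hx
    rw [← hpt]
    rcases hp with ⟨hv, h⟩ | ⟨hv, h⟩
    · exact key (e, false) hv x ⟨hx.1.le, h⟩
    · have := key (e, true) hv (Γ.len e - x) ⟨sub_nonneg.2 hx.2.le, h⟩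
      simpa using this

/-- The star is open, and so is the rest of the set where `f ≠ 0`, because the tips of the arms are
zeros of `f`. -/
theorem connectedComponentIn_starAt (P : Γ.Profile k f l D) (hc : Continuous f) {v : V}
    {p : Γ.Pt} (hp : p ∈ Γ.starAt l v) :
    connectedComponentIn (Γ.innerPt '' Γ.nodalPoints f)ᶜ p = Γ.starAt l v := by
  rw [P.compl_nodal]
  refine (P.isPreconnected_starAt v).connectedComponentIn_eq_of_isOpen
    (fun _ => P.ne_zero_of_mem_starAt) hp ?_ ?_
  · refine Γ.isOpen_of_edges (fun e => {x | (Γ.endpt e false = v ∧ x < l (e, false)) ∨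
      (Γ.endpt e true = v ∧ Γ.len e - x < l (e, true))}) (fun e => ?_)
      fun e x hx => P.pt_mem_starAt hx
    exact (isOpen_const.and (isOpen_lt continuous_id continuous_const)).union
      (isOpen_const.and (isOpen_lt (continuous_const.sub continuous_id) continuous_const))
  -- The non-strict inequalities describing the complement of the star may be made strict, since
  -- equality would give a zero of `f`.
  · refine Γ.isOpen_of_edges (fun e => {x | f (Γ.pt e x) ≠ 0 ∧
      (¬ Γ.endpt e false = v ∨ l (e, false) < x) ∧
      (¬ Γ.endpt e true = v ∨ l (e, true) < Γ.len e - x)}) (fun e => ?_) fun e x hx => ?_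
    · have h1 : IsOpen {x | f (Γ.pt e x) ≠ 0} :=
        isOpen_ne.preimage (hc.comp (Γ.continuous_pt e))
      exact h1.inter ((isOpen_const.union (isOpen_lt continuous_const continuous_id)).inter
        (isOpen_const.union (isOpen_lt continuous_const (continuous_const.sub continuous_id))))
    · rw [Set.mem_sdiff, P.pt_mem_starAt hx]
      have h1 : x = l (e, false) → f (Γ.pt e x) = 0 := by
        rintro rfl
        exact P.eq_zero_at (e, false)
      have h2 : Γ.len e - x = l (e, true) → f (Γ.pt e x) = 0 := by
        intro h
        have := P.eq_zero_at (e, true)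
        rwa [← h, pos_true, sub_sub_cancel] at this
      simp only [mem_ofPred_eq, not_or, not_and, not_lt]
      constructor
      · rintro ⟨h0, h3, h4⟩
        refine ⟨h0, ?_, ?_⟩
        · by_cases hv : Γ.endpt e false = v
          · exact Or.inr ((h3 hv).lt_of_ne fun h => h0 (h1 h.symm))
          · exact Or.inl hv
        · by_cases hv : Γ.endpt e true = v
          · exact Or.inr ((h4 hv).lt_of_ne fun h => h0 (h2 h.symm))
          · exact Or.inl hv
      · rintro ⟨h0, h3, h4⟩
        exact ⟨h0, fun hv => (h3.resolve_left (not_not.2 hv)).le,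
          fun hv => (h4.resolve_left (not_not.2 hv)).le⟩

theorem connectedComponentIn_segment (P : Γ.Profile k f l D) (hc : Continuous f) {e : E}
    {a b : ℝ} (ha : 0 ≤ a) (hb : b ≤ Γ.len e) (hfa : f (Γ.pt e a) = 0) (hfb : f (Γ.pt e b) = 0)
    (hf : ∀ x ∈ Ioo a b, f (Γ.pt e x) ≠ 0) {p : Γ.Pt} (hp : p ∈ Γ.segment e a b) :
    connectedComponentIn (Γ.innerPt '' Γ.nodalPoints f)ᶜ p = Γ.segment e a b := by
  rw [P.compl_nodal]
  refine (Γ.isPreconnected_segment ha hb).connectedComponentIn_eq_of_isOpen ?_ hp ?_ ?_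
  · rintro (u | ⟨e', x, hx⟩) hp
    · exact hp.elim
    · obtain ⟨he, hx'⟩ := hp
      obtain rfl : e' = e := he
      have := hf x hx'
      rwa [Γ.pt_of_mem hx] at this
  · exact Γ.isOpen_of_edges (fun e' => {x | e' = e ∧ x ∈ Ioo a b})
      (fun e' => isOpen_const.and isOpen_Ioo) fun e' x hx => Γ.pt_mem_segment ha hb hx
  · refine Γ.isOpen_of_edges (fun e' => {x | f (Γ.pt e' x) ≠ 0 ∧ (¬ e' = e ∨ x < a ∨ b < x)})
      (fun e' => ?_) fun e' x hx => ?_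
    · have h1 : IsOpen {x | f (Γ.pt e' x) ≠ 0} :=
        isOpen_ne.preimage (hc.comp (Γ.continuous_pt e'))
      exact h1.inter (isOpen_const.union ((isOpen_lt continuous_id continuous_const).union
        (isOpen_lt continuous_const continuous_id)))
    · rw [Set.mem_sdiff, Γ.pt_mem_segment ha hb hx]
      simp only [mem_ofPred_eq, not_and]
      refine and_congr_right fun h0 => ?_
      by_cases he : e' = e
      · subst he
        have hxa : x ≠ a := fun h => h0 (h ▸ hfa)
        have hxb : x ≠ b := fun h => h0 (h ▸ hfb)
        simp only [mem_Ioo, not_and, not_lt, true_imp_iff, not_true, false_or]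
        constructor
        · intro h
          rcases lt_or_gt_of_ne hxa with h1 | h1
          · exact Or.inl h1
          · exact Or.inr ((h h1).lt_of_ne hxb.symm)
        · rintro (h | h) h1
          · exact absurd h h1.not_gt
          · exact h.le
      · simp [he]

/-- Every nodal domain is a star at a vertex or a segment between two adjacent zeros. -/
theorem nodalDomain_cases (P : Γ.Profile k f l D) (hc : Continuous f) {Ω : Set Γ.Pt}
    (hΩ : Γ.IsNodalDomain f Ω) :
    (∃ v, Ω = Γ.starAt l v) ∨ ∃ (e : E) (a : ℝ) (D' : ℂ), 0 < a ∧ a + Real.pi / k < Γ.len e ∧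
      D' ≠ 0 ∧ (∀ x ∈ Icc 0 (Γ.len e), f (Γ.pt e x) = D' * (Real.sin (k * (x - a)) : ℝ)) ∧
      Ω = Γ.segment e a (a + Real.pi / k) := by
  obtain ⟨p, hp, rfl⟩ := hΩ
  have hp' := hp
  rw [P.compl_nodal] at hp'
  rcases p with v | ⟨e, x, hx⟩
  · exact Or.inl ⟨v, P.connectedComponentIn_starAt hc rfl⟩
  by_cases h1 : x < l (e, false)
  · exact Or.inl ⟨Γ.endpt e false, P.connectedComponentIn_starAt hc (Or.inl ⟨rfl, h1⟩)⟩
  by_cases h2 : Γ.len e - x < l (e, true)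
  · exact Or.inl ⟨Γ.endpt e true, P.connectedComponentIn_starAt hc (Or.inr ⟨rfl, h2⟩)⟩
  right
  have hk := P.k_pos
  have hpi := Real.pi_pos
  have hd := div_pos hpi hk
  have hxI : x ∈ Icc 0 (Γ.len e) := ⟨hx.1.le, hx.2.le⟩
  have hfx : f (Γ.pt e x) ≠ 0 := by rw [Γ.pt_of_mem hx]; exact hp'
  set c := l (e, false) with hcdef
  have hc0 : 0 < c := P.dist_pos _
  set d := Γ.len e - l (e, true) with hddef
  have hl := P.dist_pos (e, true)
  have hl' := P.lt_len (e, true)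
  simp only at hl'
  have hform : ∀ y ∈ Icc 0 (Γ.len e), f (Γ.pt e y) = D (e, false) * (Real.sin (k * (c - y)) : ℝ) :=
    P.formula (e, false)
  -- Zeros on the edge are spaced by `π / k` starting from the first one, `c`; thus `a` is the last
  -- zero not beyond `x`.
  set j := ⌊(x - c) / (Real.pi / k)⌋₊ with hj
  set a := c + j * (Real.pi / k) with ha
  have hcx : 0 ≤ x - c := by linarith
  have hax : a ≤ x := by
    have := Nat.floor_le (div_nonneg hcx hd.le)
    rw [le_div_iff₀ hd, ← hj] at this
    linarith
  have hxb : x < a + Real.pi / k := by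
    have := Nat.lt_floor_add_one ((x - c) / (Real.pi / k))
    rw [div_lt_iff₀ hd, ← hj] at this
    linarith
  have hca : c ≤ a := by
    have : 0 ≤ j * (Real.pi / k) := by positivity
    linarith
  -- The point `d` is also a zero, so it is `c` plus an integer multiple of `π / k`. It lies beyond
  -- `x`, so the multiple exceeds `j` and is at least `j + 1`.
  have hbd : a + Real.pi / k ≤ d := by
    have hdz : f (Γ.pt e d) = 0 := by
      have := P.eq_zero_at (e, true)
      rwa [pos_true] at this
    rw [hform d ⟨by linarith, by linarith⟩] at hdz
    have hs : Real.sin (k * (c - d)) = 0 := by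
      have := (mul_eq_zero.1 hdz).resolve_left (P.amp_ne_zero _)
      exact_mod_cast this
    obtain ⟨m, hm⟩ := Real.sin_eq_zero_iff.1 hs
    have hm' : d = c + (-m : ℤ) * (Real.pi / k) := by
      push_cast
      field_simp
      linarith
    have hxd : x ≤ d := by linarith
    have hlt : (j : ℝ) * (Real.pi / k) < (-m : ℤ) * (Real.pi / k) := by
      have : x ≠ d := by
        rintro rfl
        exact hfx ((hform _ hxI).trans hdz)
      have := lt_of_le_of_ne hxd this
      linarith
    have hjm : (j : ℤ) < -m := by
      have := lt_of_mul_lt_mul_right hlt hd.le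
      exact_mod_cast this
    have hjm' : (j : ℝ) + 1 ≤ ((-m : ℤ) : ℝ) := by exact_mod_cast hjm
    have := mul_le_mul_of_nonneg_right hjm' hd.le
    rw [hm', ha]
    linarith
  have hform' : ∀ y ∈ Icc 0 (Γ.len e),
      f (Γ.pt e y) = (-(D (e, false) * (-1) ^ j)) * (Real.sin (k * (y - a)) : ℝ) := by
    intro y hy
    rw [hform y hy]
    have : k * (y - a) = -(k * (c - y)) - j * Real.pi := by
      rw [ha]
      field_simp
      ring
    rw [this, Real.sin_sub_nat_mul_pi, Real.sin_neg]
    push_cast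
    have h1 : ((-1 : ℂ) ^ j) * (-1) ^ j = 1 := by rw [← mul_pow]; simp
    linear_combination (-(D (e, false) * Complex.sin (k * (c - y)))) * h1
  have hD' : -(D (e, false) * (-1) ^ j) ≠ 0 := by simp [P.amp_ne_zero]
  have hza : f (Γ.pt e a) = 0 := by
    rw [hform' a ⟨by linarith, by linarith⟩]
    simp
  have hzb : f (Γ.pt e (a + Real.pi / k)) = 0 := by
    rw [hform' _ ⟨by linarith, by linarith⟩, add_sub_cancel_left, mul_div_cancel₀ _ hk.ne']
    simp
  have hnz : ∀ y ∈ Ioo a (a + Real.pi / k), f (Γ.pt e y) ≠ 0 := by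
    intro y hy
    rw [hform' y ⟨by linarith [hy.1], by linarith [hy.2]⟩]
    refine mul_ne_zero hD' ?_
    have : 0 < Real.sin (k * (y - a)) := by
      refine Real.sin_pos_of_pos_of_lt_pi (mul_pos hk (by linarith [hy.1])) ?_
      have : y - a < Real.pi / k := by linarith [hy.2]
      rw [lt_div_iff₀ hk] at this
      linarith
    exact_mod_cast this.ne'
  refine ⟨e, a, _, by linarith, by linarith, hD', hform', ?_⟩
  refine P.connectedComponentIn_segment hc (by linarith) (by linarith) hza hzb hnz ⟨rfl, ?_, hxb⟩
  exact hax.lt_of_ne fun h => hfx (h ▸ hza)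

end Profile

/-! ### Points measured from an edge end, and boundary counts -/

open Classical in
/-- The interior point at distance `t` from the end `h`, for `0 < t < len h.1`. -/
noncomputable def pointAt (Γ : MetricGraph V E) (h : E × Bool) (t : ℝ) :
    Σ e : E, Ioo (0 : ℝ) (Γ.len e) :=
  ⟨h.1, if ht : Γ.pos h t ∈ Ioo 0 (Γ.len h.1) then ⟨_, ht⟩ else
    ⟨Γ.len h.1 / 2, half_pos (Γ.len_pos _), half_lt_self (Γ.len_pos _)⟩⟩

theorem coe_pointAt (Γ : MetricGraph V E) {h : E × Bool} {t : ℝ} (ht : t ∈ Ioo 0 (Γ.len h.1)) :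
    ((Γ.pointAt h t).2 : ℝ) = Γ.pos h t := by
  simp only [pointAt]
  rw [dif_pos (Γ.pos_mem_Ioo ht)]

theorem innerPt_pointAt (Γ : MetricGraph V E) {h : E × Bool} {t : ℝ}
    (ht : t ∈ Ioo 0 (Γ.len h.1)) : Γ.innerPt (Γ.pointAt h t) = Γ.pt h.1 (Γ.pos h t) := by
  rw [Γ.pt_of_mem (Γ.pos_mem_Ioo ht)]
  simp only [pointAt]
  rw [dif_pos (Γ.pos_mem_Ioo ht)]

theorem exists_pointAt (Γ : MetricGraph V E) (q : Σ e : E, Ioo (0 : ℝ) (Γ.len e)) (b : Bool) :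
    ∃ t ∈ Ioo 0 (Γ.len q.1), q = Γ.pointAt (q.1, b) t := by
  obtain ⟨e, x, hx⟩ := q
  refine ⟨Γ.pos (e, b) x, Γ.pos_mem_Ioo (h := (e, b)) hx, ?_⟩
  have : Γ.pos (e, b) (Γ.pos (e, b) x) ∈ Ioo 0 (Γ.len e) := by rwa [pos_pos]
  simp only [pointAt]
  rw [dif_pos this]
  simp

theorem pointAt_mem_neumannPointsIn (Γ : MetricGraph V E) {f : Γ.Pt → ℂ} {Ω : Set Γ.Pt}
    {h : E × Bool} {t : ℝ} (ht : t ∈ Ioo 0 (Γ.len h.1)) :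
    Γ.pointAt h t ∈ Γ.neumannPointsIn f Ω ↔
      deriv (Γ.onEdge f h.1) (Γ.pos h t) = 0 ∧ Γ.pt h.1 (Γ.pos h t) ∈ Ω := by
  rw [← Γ.innerPt_pointAt ht, ← Γ.coe_pointAt ht]
  exact Iff.rfl

/-- The boundary vertices of `Ω` at nodal points. -/
def nodalBoundary (Γ : MetricGraph V E) (f : Γ.Pt → ℂ) (Ω : Set Γ.Pt) :
    Set ((Σ e : E, Ioo (0 : ℝ) (Γ.len e)) × Bool) :=
  Sum.inr ⁻¹' Γ.boundary f Ω

theorem pointAt_mem_nodalBoundary (Γ : MetricGraph V E) {f : Γ.Pt → ℂ} {Ω : Set Γ.Pt}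
    {h : E × Bool} {t : ℝ} (ht : t ∈ Ioo 0 (Γ.len h.1)) :
    (Γ.pointAt h t, h.2) ∈ Γ.nodalBoundary f Ω ↔ f (Γ.pt h.1 (Γ.pos h t)) = 0 ∧
      ∀ᶠ s in 𝓝[<] t, Γ.pt h.1 (Γ.pos h s) ∈ Ω := by
  have h1 : Γ.pointAt h t ∈ Γ.nodalPoints f ↔ f (Γ.pt h.1 (Γ.pos h t)) = 0 := by
    rw [← Γ.innerPt_pointAt ht]
    exact Iff.rfl
  have h2 := Γ.coe_pointAt ht
  rcases h with ⟨e, _ | _⟩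
  · rw [← h1, nodalBoundary, boundary]
    simp [h2]
    exact fun _ => Iff.rfl
  · rw [← h1, nodalBoundary, boundary]
    simp only [pos_true]
    rw [eventually_nhdsLT_sub_iff (p := fun y => Γ.pt e y ∈ Ω)]
    simp [h2]
    exact fun _ => Iff.rfl

theorem boundary_eq (Γ : MetricGraph V E) (f : Γ.Pt → ℂ) (Ω : Set Γ.Pt) :
    Γ.boundary f Ω = Sum.inl '' {v | Γ.degree v = 1 ∧ Γ.vtx v ∈ Ω} ∪
      Sum.inr '' Γ.nodalBoundary f Ω := by
  ext (v | s)
  · simp [boundary]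
  · simp [nodalBoundary]

theorem finite_boundary [Finite V] (Γ : MetricGraph V E) {f : Γ.Pt → ℂ} {Ω : Set Γ.Pt}
    (h : (Γ.nodalBoundary f Ω).Finite) : (Γ.boundary f Ω).Finite := by
  rw [boundary_eq]
  exact ((toFinite _).image _).union (h.image _)

theorem ncard_boundary [Finite V] (Γ : MetricGraph V E) {f : Γ.Pt → ℂ} {Ω : Set Γ.Pt}
    (h : (Γ.nodalBoundary f Ω).Finite) : (Γ.boundary f Ω).ncard =
      {v | Γ.degree v = 1 ∧ Γ.vtx v ∈ Ω}.ncard + (Γ.nodalBoundary f Ω).ncard := by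
  rw [boundary_eq, ncard_union_eq ?_ ((toFinite _).image _) (h.image _),
    ncard_image_of_injective _ Sum.inl_injective, ncard_image_of_injective _ Sum.inr_injective]
  rw [Set.disjoint_left]
  rintro _ ⟨v, -, rfl⟩ ⟨s, -, hs⟩
  exact Sum.inr_ne_inl hs

/-! ### Neumann points, boundary and length of a star -/

namespace Profile

variable {Γ : MetricGraph V E} {k : ℝ} {f : Γ.Pt → ℂ} {l : E × Bool → ℝ} {D : E × Bool → ℂ}

theorem dist_mem_Ioo (P : Γ.Profile k f l D) (h : E × Bool) : l h ∈ Ioo 0 (Γ.len h.1) :=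
  ⟨P.dist_pos h, P.lt_len h⟩

theorem exists_pointAt_of_mem_starAt {v : V} {q : Σ e : E, Ioo (0 : ℝ) (Γ.len e)}
    (hq : Γ.innerPt q ∈ Γ.starAt l v) : ∃ h : E × Bool, Γ.endpt h.1 h.2 = v ∧
      ∃ t ∈ Ioo 0 (Γ.len h.1), t < l h ∧ q = Γ.pointAt h t := by
  have key : ∀ b, ∃ t ∈ Ioo 0 (Γ.len q.1), q = Γ.pointAt (q.1, b) t ∧
      (q.2 : ℝ) = Γ.pos (q.1, b) t := by
    intro b
    obtain ⟨t, ht, hqt⟩ := Γ.exists_pointAt q b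
    refine ⟨t, ht, hqt, ?_⟩
    rw [← Γ.coe_pointAt (h := (q.1, b)) ht, ← hqt]
  rcases hq with ⟨hv, hl⟩ | ⟨hv, hl⟩
  · obtain ⟨t, ht, hqt, h⟩ := key false
    exact ⟨_, hv, t, ht, by rw [h] at hl; exact hl, hqt⟩
  · obtain ⟨t, ht, hqt, h⟩ := key true
    exact ⟨_, hv, t, ht, by rwa [h, pos_true, sub_sub_cancel] at hl, hqt⟩

/-- Along an arm the phase `k * (l h - t)` decreases from `k * l h < π` to `0`, so its cosine
vanishes only at phase `π / 2`. This phase is reached inside the arm exactly when `k * l h > π / 2`.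
-/
theorem neumannPointsIn_starAt (P : Γ.Profile k f l D) (v : V) :
    Γ.neumannPointsIn f (Γ.starAt l v) =
      (fun h => Γ.pointAt h (l h - Real.pi / 2 / k)) ''
        {h | Γ.endpt h.1 h.2 = v ∧ 0 < k * l h - Real.pi / 2} := by
  have hk := P.k_pos
  have hd : 0 < Real.pi / 2 / k := by positivity
  ext q
  constructor
  · intro hq
    obtain ⟨h, hv, t, ht, htl, rfl⟩ := exists_pointAt_of_mem_starAt hq.2
    have hder := ((Γ.pointAt_mem_neumannPointsIn ht).1 hq).1
    rw [P.deriv_eq_zero_iff ht] at hder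
    have := Real.eq_pi_div_two_of_cos_eq_zero (mul_pos hk (sub_pos.2 htl)) (by
      have := P.lt_pi h
      nlinarith [mul_pos hk ht.1]) hder
    have htt : t = l h - Real.pi / 2 / k := by
      rw [← this]
      field_simp
      ring
    refine ⟨h, ⟨hv, ?_⟩, by simp only [htt]⟩
    nlinarith [mul_pos hk ht.1]
  · rintro ⟨h, ⟨hv, hl⟩, rfl⟩
    have h0 : 0 < l h - Real.pi / 2 / k := by
      rw [sub_pos, div_lt_iff₀ hk]
      linarith
    have h1 := P.lt_len h
    have ht : l h - Real.pi / 2 / k ∈ Ioo 0 (Γ.len h.1) := ⟨h0, by linarith⟩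
    rw [Γ.pointAt_mem_neumannPointsIn ht, P.deriv_eq_zero_iff ht,
      P.pt_pos_mem_starAt ⟨ht.1.le, ht.2.le⟩]
    refine ⟨?_, Or.inl ⟨hv, by linarith⟩⟩
    rw [sub_sub_cancel, mul_div_cancel₀ _ hk.ne', Real.cos_pi_div_two]

/-- Distinct arms are disjoint even when they are the two halves of one loop, by `add_le_len`. This
makes the count of Neumann points a count of edge ends. -/
theorem eq_of_pointAt_eq (P : Γ.Profile k f l D) {h h' : E × Bool} {t t' : ℝ}
    (ht : t ∈ Ioo 0 (Γ.len h.1)) (ht' : t' ∈ Ioo 0 (Γ.len h'.1)) (hl : t < l h) (hl' : t' < l h')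
    (heq : Γ.pointAt h t = Γ.pointAt h' t') : h = h' := by
  have h1 : h.1 = h'.1 := congrArg Sigma.fst heq
  have h2 : Γ.pos h t = Γ.pos h' t' := by
    rw [← Γ.coe_pointAt ht, ← Γ.coe_pointAt ht']
    exact congrArg (fun q : Σ e : E, Ioo (0 : ℝ) (Γ.len e) => (q.2 : ℝ)) heq
  obtain ⟨e, b⟩ := h
  obtain ⟨e', b'⟩ := h'
  obtain rfl : e = e' := h1
  have h3 := P.add_le_len (e, true)
  simp only [Bool.not_true] at h3
  rcases b with _ | _ <;> rcases b' with _ | _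
  · rfl
  · simp only [pos_false, pos_true] at h2
    linarith
  · simp only [pos_false, pos_true] at h2
    linarith
  · rfl

theorem ncard_neumannPointsIn_starAt (P : Γ.Profile k f l D) (v : V) :
    (Γ.neumannPointsIn f (Γ.starAt l v)).ncard =
      {h : E × Bool | Γ.endpt h.1 h.2 = v ∧ 0 < k * l h - Real.pi / 2}.ncard := by
  rw [P.neumannPointsIn_starAt]
  refine InjOn.ncard_image ?_
  have hk := P.k_pos
  have hd : 0 < Real.pi / 2 / k := by positivity
  have key : ∀ h : E × Bool, 0 < k * l h - Real.pi / 2 →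
      l h - Real.pi / 2 / k ∈ Ioo 0 (Γ.len h.1) := fun h hl => by
    refine ⟨?_, by linarith [P.lt_len h]⟩
    rw [sub_pos, div_lt_iff₀ hk]
    linarith
  intro h hh h' hh' heq
  exact P.eq_of_pointAt_eq (key h hh.2) (key h' hh'.2) (by linarith) (by linarith) heq

theorem nodalBoundary_starAt (P : Γ.Profile k f l D) (v : V) :
    Γ.nodalBoundary f (Γ.starAt l v) =
      (fun h => (Γ.pointAt h (l h), h.2)) '' {h | Γ.endpt h.1 h.2 = v} := by
  ext ⟨q, b⟩
  obtain ⟨t, ht, hqt⟩ := Γ.exists_pointAt q b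
  set h : E × Bool := (q.1, b) with hh
  have ht' : t ∈ Ioo 0 (Γ.len h.1) := ht
  rw [hqt]
  have hmem := Γ.pointAt_mem_nodalBoundary (f := f) (Ω := Γ.starAt l v) ht'
  constructor
  · intro hs
    obtain ⟨hz, hev⟩ := hmem.1 hs
    have hlt : l h ≤ t := by
      by_contra! hlt
      exact P.ne_zero_of_lt ht.1.le hlt hz
    have hzb : l (h.1, !h.2) ≤ Γ.len h.1 - t := by
      by_contra! hlt
      refine P.ne_zero_of_lt (h := (h.1, !h.2)) (sub_nonneg.2 ht.2.le) hlt ?_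
      rw [pos_not, sub_sub_cancel]
      exact hz
    have h1 : ∀ᶠ s in 𝓝[<] t, s ∈ Ioo 0 t := Ioo_mem_nhdsLT ht.1
    obtain ⟨s, hsS, hs⟩ := (hev.and h1).exists
    rw [P.pt_pos_mem_starAt ⟨hs.1.le, (hs.2.trans ht.2).le⟩] at hsS
    have hv : Γ.endpt h.1 h.2 = v := by
      rcases hsS with hsS | hsS
      · exact hsS.1
      · linarith [hsS.2, hs.2]
    -- If `t` were beyond `l h`, points just before `t` would be past the arm from `h`. They would
    -- not be on the arm from the other end either, as `t` is a zero and that arm does not reach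
    -- across it.
    have htl : t = l h := by
      refine le_antisymm (le_of_not_gt fun hlt' => ?_) hlt
      have h2 : ∀ᶠ s in 𝓝[<] t, s ∈ Ioo (l h) t := Ioo_mem_nhdsLT hlt'
      obtain ⟨s, hsS, hs⟩ := (hev.and h2).exists
      rw [P.pt_pos_mem_starAt ⟨((P.dist_pos h).trans hs.1).le, (hs.2.trans ht.2).le⟩] at hsS
      rcases hsS with hsS | hsS
      · linarith [hsS.2, hs.1]
      · linarith [hsS.2, hs.2]
    exact ⟨h, hv, by rw [htl]⟩
  · rintro ⟨h', hv, heq⟩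
    have heq' := Prod.ext_iff.1 heq
    simp only at heq'
    have h1 : h' = h := Prod.ext (congrArg Sigma.fst heq'.1) heq'.2
    subst h1
    have h2 : t = l h := by
      have h3 : Γ.pos h (l h) = Γ.pos h t := by
        rw [← Γ.coe_pointAt ht', ← Γ.coe_pointAt (P.dist_mem_Ioo h)]
        exact congrArg (fun q : Σ e : E, Ioo (0 : ℝ) (Γ.len e) => (q.2 : ℝ)) heq'.1
      rw [← Γ.pos_pos h t, ← h3, pos_pos]
    refine hmem.2 ⟨by rw [h2]; exact P.eq_zero_at h, ?_⟩
    filter_upwards [Ioo_mem_nhdsLT ht.1] with s hs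
    rw [P.pt_pos_mem_starAt ⟨hs.1.le, (hs.2.trans ht.2).le⟩]
    exact Or.inl ⟨hv, h2 ▸ hs.2⟩

/-- Recording the side of approach keeps the count injective when both ends of a loop reach the same
nodal point. -/
theorem ncard_nodalBoundary_starAt (P : Γ.Profile k f l D) (v : V) :
    (Γ.nodalBoundary f (Γ.starAt l v)).ncard = Γ.degree v := by
  rw [P.nodalBoundary_starAt, degree]
  refine ncard_image_of_injective _ fun h h' heq => ?_
  have := Prod.ext_iff.1 heq
  exact Prod.ext (congrArg Sigma.fst this.1) this.2

open Classical in
theorem totalLen_starAt [Fintype E] (P : Γ.Profile k f l D) (v : V) :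
    Γ.totalLen (Γ.starAt l v) =
      ∑ h ∈ Finset.univ.filter (fun h : E × Bool => Γ.endpt h.1 h.2 = v), l h := by
  rw [Finset.sum_filter, Fintype.sum_prod_type, totalLen]
  refine Finset.sum_congr rfl fun e _ => ?_
  have h0 := P.lt_len (e, false)
  have h1 := P.lt_len (e, true)
  have h2 := P.dist_pos (e, false)
  have h3 := P.dist_pos (e, true)
  have h4 := P.add_le_len (e, true)
  simp only [Bool.not_true] at h0 h1 h4
  have hset : {x : ℝ | x ∈ Ioo 0 (Γ.len e) ∧ Γ.pt e x ∈ Γ.starAt l v} =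
      (if Γ.endpt e false = v then Ioo 0 (l (e, false)) else ∅) ∪
      (if Γ.endpt e true = v then Ioo (Γ.len e - l (e, true)) (Γ.len e) else ∅) := by
    ext x
    simp only [mem_ofPred_eq, mem_union, mem_ite_empty_right, mem_Ioo]
    constructor
    · rintro ⟨hx, hS⟩
      rw [P.pt_mem_starAt ⟨hx.1.le, hx.2.le⟩] at hS
      rcases hS with ⟨hv, hl⟩ | ⟨hv, hl⟩
      · exact Or.inl ⟨hv, hx.1, hl⟩
      · exact Or.inr ⟨hv, by linarith, hx.2⟩
    · rintro (⟨hv, hx⟩ | ⟨hv, hx⟩)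
      · refine ⟨⟨hx.1, hx.2.trans h0⟩, ?_⟩
        rw [P.pt_mem_starAt ⟨hx.1.le, (hx.2.trans h0).le⟩]
        exact Or.inl ⟨hv, hx.2⟩
      · have hx0 : 0 < x := by linarith [hx.1]
        refine ⟨⟨hx0, hx.2⟩, ?_⟩
        rw [P.pt_mem_starAt ⟨hx0.le, hx.2.le⟩]
        exact Or.inr ⟨hv, by linarith [hx.1]⟩
  have hv0 : volume.real (if Γ.endpt e false = v then Ioo 0 (l (e, false)) else ∅) =
      if Γ.endpt e false = v then l (e, false) else 0 := by
    split_ifs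
    · rw [Real.volume_real_Ioo_of_le h2.le, sub_zero]
    · simp
  have hv1 : volume.real
      (if Γ.endpt e true = v then Ioo (Γ.len e - l (e, true)) (Γ.len e) else ∅) =
      if Γ.endpt e true = v then l (e, true) else 0 := by
    split_ifs
    · rw [Real.volume_real_Ioo_of_le (by linarith), sub_sub_cancel]
    · simp
  have hf0 : volume (if Γ.endpt e false = v then Ioo 0 (l (e, false)) else ∅) ≠ ⊤ := by
    split_ifs <;> simp
  have hf1 : volume
      (if Γ.endpt e true = v then Ioo (Γ.len e - l (e, true)) (Γ.len e) else ∅) ≠ ⊤ := by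
    split_ifs <;> simp
  rw [hset, measureReal_union ?_ ?_ hf0 hf1, hv0, hv1, Fintype.sum_bool, add_comm]
  · rw [Set.disjoint_left]
    intro x hx hx'
    rw [mem_ite_empty_right] at hx hx'
    linarith [hx.2.2, hx'.2.1]
  · split_ifs
    · exact measurableSet_Ioo
    · exact MeasurableSet.empty

end Profile

/-! ### Length, Neumann points and boundary of a segment -/

section Segment

variable {Γ : MetricGraph V E} {k : ℝ} {f : Γ.Pt → ℂ} {e : E} {a : ℝ} {D : ℂ}

theorem totalLen_segment [Fintype E] {b : ℝ} (ha : 0 ≤ a) (hab : a ≤ b) (hb : b ≤ Γ.len e) :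
    Γ.totalLen (Γ.segment e a b) = b - a := by
  classical
  have key : ∀ e', volume.real {x : ℝ | x ∈ Ioo 0 (Γ.len e') ∧ Γ.pt e' x ∈ Γ.segment e a b} =
      if e' = e then b - a else 0 := by
    intro e'
    split_ifs with he
    · subst he
      rw [← Real.volume_real_Ioo_of_le hab]
      congr 1
      ext x
      constructor
      · rintro ⟨hx, hS⟩
        exact ((Γ.pt_mem_segment ha hb ⟨hx.1.le, hx.2.le⟩).1 hS).2
      · intro hx
        have hx' : x ∈ Ioo 0 (Γ.len e') := ⟨ha.trans_lt hx.1, hx.2.trans_le hb⟩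
        exact ⟨hx', (Γ.pt_mem_segment ha hb ⟨hx'.1.le, hx'.2.le⟩).2 ⟨rfl, hx⟩⟩
    · convert measureReal_empty
      ext x
      simp only [mem_ofPred_eq, mem_empty_iff_false, iff_false]
      rintro ⟨hx, hS⟩
      exact he ((Γ.pt_mem_segment ha hb ⟨hx.1.le, hx.2.le⟩).1 hS).1
  rw [totalLen, Finset.sum_congr rfl fun e' _ => key e']
  simp

theorem neumannPointsIn_segment (hk : 0 < k) (ha : 0 < a) (hb : a + Real.pi / k < Γ.len e)
    (hD : D ≠ 0)
    (hf : ∀ x ∈ Icc 0 (Γ.len e), f (Γ.pt e x) = D * (Real.sin (k * (x - a)) : ℝ)) :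
    Γ.neumannPointsIn f (Γ.segment e a (a + Real.pi / k)) =
      {Γ.pointAt (e, false) (a + Real.pi / 2 / k)} := by
  have hpi := Real.pi_pos
  have hd : 0 < Real.pi / 2 / k := by positivity
  have hd2 : Real.pi / k = Real.pi / 2 / k + Real.pi / 2 / k := by ring
  have hder : ∀ t ∈ Ioo 0 (Γ.len e), deriv (Γ.onEdge f e) t = 0 ↔ Real.cos (k * (t - a)) = 0 := by
    intro t ht
    rw [Γ.deriv_onEdge (f := f) (e := e) (D := D) (α := k) (β := -(k * a)) (fun x hx => by
      rw [hf x hx]; congr 3; ring) ht, show k * t + -(k * a) = k * (t - a) by ring]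
    simp [hD, hk.ne', -Complex.ofReal_cos]
  ext q
  rw [mem_singleton_iff]
  constructor
  · intro hq
    obtain ⟨t, ht, hqt⟩ := Γ.exists_pointAt q false
    have he : q.1 = e := hq.2.1
    rw [he] at hqt ht
    rw [hqt] at hq ⊢
    have ht' : t ∈ Ioo 0 (Γ.len ((e, false) : E × Bool).1) := ht
    obtain ⟨h1, h2⟩ := (Γ.pointAt_mem_neumannPointsIn ht').1 hq
    rw [pos_false] at h1 h2
    have h3 := ((Γ.pt_mem_segment ha.le hb.le ⟨ht.1.le, ht.2.le⟩).1 h2).2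
    have h4 : k * (t - a) < Real.pi := by
      have : t - a < Real.pi / k := by linarith [h3.2]
      rw [lt_div_iff₀ hk] at this
      linarith
    have h5 := Real.eq_pi_div_two_of_cos_eq_zero (mul_pos hk (sub_pos.2 h3.1)) h4 ((hder t ht).1 h1)
    congr 1
    rw [← h5]
    field_simp
    ring
  · rintro rfl
    have ht : a + Real.pi / 2 / k ∈ Ioo 0 (Γ.len e) := ⟨by linarith, by linarith⟩
    refine (Γ.pointAt_mem_neumannPointsIn (h := (e, false)) ht).2 ⟨?_, ?_⟩
    · rw [pos_false, hder _ ht, add_sub_cancel_left, mul_div_cancel₀ _ hk.ne',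
        Real.cos_pi_div_two]
    · rw [pos_false, Γ.pt_mem_segment ha.le hb.le ⟨ht.1.le, ht.2.le⟩]
      exact ⟨rfl, by linarith, by linarith⟩

theorem nodalBoundary_segment {b : ℝ} (ha : 0 < a) (hab : a < b) (hb : b < Γ.len e)
    (hfa : f (Γ.pt e a) = 0) (hfb : f (Γ.pt e b) = 0)
    (hf : ∀ x ∈ Ioo a b, f (Γ.pt e x) ≠ 0) :
    Γ.nodalBoundary f (Γ.segment e a b) =
      {(Γ.pointAt (e, false) b, false), (Γ.pointAt (e, true) (Γ.len e - a), true)} := by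
  have hbI : b ∈ Ioo 0 (Γ.len e) := ⟨ha.trans hab, hb⟩
  have haI : Γ.len e - a ∈ Ioo 0 (Γ.len e) := ⟨by linarith, by linarith⟩
  ext ⟨q, c⟩
  constructor
  · intro hs
    obtain ⟨t, ht, hqt⟩ := Γ.exists_pointAt q c
    set h : E × Bool := (q.1, c) with hh
    have ht' : t ∈ Ioo 0 (Γ.len h.1) := ht
    rw [hqt] at hs ⊢
    obtain ⟨hz, hev⟩ := (Γ.pointAt_mem_nodalBoundary (h := h) ht').1 hs
    have hmem : ∀ᶠ s in 𝓝[<] t, h.1 = e ∧ Γ.pos h s ∈ Ioo a b := by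
      filter_upwards [hev, Ioo_mem_nhdsLT ht.1] with s hsS hs
      exact (Γ.pt_mem_segment ha.le hb.le
        (Γ.pos_mem_Icc (h := h) ⟨hs.1.le, (hs.2.trans ht.2).le⟩)).1 hsS
    have he : q.1 = e := hmem.exists.choose_spec.1
    -- The nodal point is a limit of points of the segment, hence in its closure, and no zero lies
    -- strictly inside; the side of approach then selects the end.
    have hcl : Γ.pos h t ∈ Icc a b := by
      refine isClosed_Icc.mem_of_tendsto (b := 𝓝[<] t)
        (((Γ.continuous_pos h).tendsto t).mono_left nhdsWithin_le_nhds) ?_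
      exact hmem.mono fun s hs => ⟨hs.2.1.le, hs.2.2.le⟩
    have hcl' : Γ.pos h t = a ∨ Γ.pos h t = b := by
      by_contra! hne
      refine hf (Γ.pos h t) ⟨hcl.1.lt_of_ne hne.1.symm, hcl.2.lt_of_ne hne.2⟩ ?_
      rw [← hz]
      simp only [hh, he]
    obtain ⟨s, hsS, hst⟩ := (hmem.and eventually_mem_nhdsWithin).exists
    have hst' : s < t := hst
    have hs2 := hsS.2
    clear_value h
    subst hh
    rcases c with _ | _
    · simp only [pos_false] at hcl' hs2
      left
      rcases hcl' with h1 | h1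
      · linarith [hs2.1]
      · rw [h1, he]
    · simp only [pos_true, he] at hcl' hs2
      right
      rcases hcl' with h1 | h1
      · rw [he, ← h1, sub_sub_cancel]
        rfl
      · linarith [hs2.2]
  · rintro (h | h)
    · rw [h]
      refine (Γ.pointAt_mem_nodalBoundary (h := (e, false)) hbI).2 ⟨hfb, ?_⟩
      filter_upwards [Ioo_mem_nhdsLT hab] with s hs
      exact (Γ.pt_mem_segment ha.le hb.le ⟨(ha.trans hs.1).le, (hs.2.trans hb).le⟩).2 ⟨rfl, hs⟩
    · rw [mem_singleton_iff] at h
      rw [h]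
      refine (Γ.pointAt_mem_nodalBoundary (h := (e, true)) haI).2 ⟨?_, ?_⟩
      · rw [pos_true, sub_sub_cancel]
        exact hfa
      · filter_upwards [Ioo_mem_nhdsLT (show Γ.len e - b < Γ.len e - a by linarith)] with s hs
        have h1 : Γ.len e - s ∈ Ioo a b := ⟨by linarith [hs.2], by linarith [hs.1]⟩
        exact (Γ.pt_mem_segment ha.le hb.le
          ⟨(ha.trans h1.1).le, (h1.2.trans hb).le⟩).2 ⟨rfl, h1⟩

end Segment

/-! ### The Kirchhoff condition and the bounds at a vertex -/

namespace Profile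

variable [Fintype E] {Γ : MetricGraph V E} {k : ℝ} {f : Γ.Pt → ℂ} {l : E × Bool → ℝ}
  {D : E × Bool → ℂ}

open Classical in
theorem sum_tan_eq_zero (P : Γ.Profile k f l D) {lam : ℝ} (hf : Γ.IsEigenfunction lam f) (v : V) :
    ∑ h ∈ Finset.univ.filter (fun h : E × Bool => Γ.endpt h.1 h.2 = v),
      Real.tan (k * l h - Real.pi / 2) = 0 := by
  have h1 := hf.kirchhoff v
  have h2 : ∀ h ∈ Finset.univ.filter (fun h : E × Bool => Γ.endpt h.1 h.2 = v),
      Γ.outDeriv f h = f (Γ.vtx v) * k * (Real.tan (k * l h - Real.pi / 2) : ℝ) := by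
    intro h hh
    rw [P.outDeriv_eq, (Finset.mem_filter.1 hh).2]
  rw [Finset.sum_congr rfl h2, ← Finset.mul_sum] at h1
  have h3 := (mul_eq_zero.1 h1).resolve_left
    (mul_ne_zero (P.ne_zero_vtx v) (by exact_mod_cast P.k_pos.ne'))
  exact_mod_cast h3

open Classical in
theorem wavelengthCapacity_starAt (P : Γ.Profile k f l D) (v : V) :
    Γ.wavelengthCapacity k (Γ.starAt l v) * Real.pi =
      ∑ h ∈ Finset.univ.filter (fun h : E × Bool => Γ.endpt h.1 h.2 = v),
        (k * l h - Real.pi / 2) + Γ.degree v * (Real.pi / 2) := by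
  have hd : Γ.degree v = (Finset.univ.filter fun h : E × Bool => Γ.endpt h.1 h.2 = v).card := by
    rw [degree, ← ncard_coe_finset]
    simp
  rw [wavelengthCapacity, P.totalLen_starAt, div_mul_cancel₀ _ Real.pi_ne_zero,
    Finset.sum_sub_distrib, Finset.sum_const, hd, Finset.sum_mul, nsmul_eq_mul, sub_add_cancel]
  exact Finset.sum_congr rfl fun h _ => mul_comm _ _

/-- The bounds for the star at a vertex, in terms of the degree. -/
theorem starAt_bounds (P : Γ.Profile k f l D) (hΓ : Γ.IsStandard) {lam : ℝ}
    (hf : Γ.IsGenericEigenfunction lam f) {v : V} (hdeg : Γ.degree v ≠ 1) :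
    1 ≤ Γ.neumannCount f (Γ.starAt l v) ∧
    Γ.neumannCount f (Γ.starAt l v) + 1 ≤ Γ.degree v ∧
    ((Γ.neumannCount f (Γ.starAt l v) : ℝ) + 1) / 2 ≤ Γ.wavelengthCapacity k (Γ.starAt l v) ∧
    Γ.wavelengthCapacity k (Γ.starAt l v) ≤
      ((Γ.neumannCount f (Γ.starAt l v) : ℝ) + Γ.degree v - 1) / 2 := by
  classical
  have hpi := Real.pi_pos
  have hsum := P.sum_tan_eq_zero hf.eigen v
  have hrho := P.wavelengthCapacity_starAt v
  set H := Finset.univ.filter (fun h : E × Bool => Γ.endpt h.1 h.2 = v) with hH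
  set x : E × Bool → ℝ := fun h => k * l h - Real.pi / 2 with hx
  set ρ := Γ.wavelengthCapacity k (Γ.starAt l v)
  have hd : Γ.degree v = H.card := by
    rw [degree, ← ncard_coe_finset]
    simp [hH]
  have hxi : Γ.neumannCount f (Γ.starAt l v) = (H.filter fun h => 0 < x h).card := by
    rw [neumannCount, P.ncard_neumannPointsIn_starAt, ← ncard_coe_finset]
    congr 1
    ext h
    simp [hH, hx]
  have hHne : H.Nonempty := by
    obtain ⟨h, hh⟩ := hΓ.exists_endpt v
    exact ⟨h, by simpa [hH] using hh⟩
  have h0 : ∀ h ∈ H, -(Real.pi / 2) < x h := fun h _ => by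
    have := mul_pos P.k_pos (P.dist_pos h)
    simp only [hx]
    linarith
  have h1 : ∀ h ∈ H, x h < Real.pi / 2 := fun h _ => by
    have := P.lt_pi h
    simp only [hx]
    linarith
  have hne : ∀ h ∈ H, x h ≠ 0 := by
    intro h hh hxh
    have hv := (Finset.mem_filter.1 hh).2
    refine hf.outDeriv_ne_zero h (by rw [hv]; exact hdeg) ?_
    rw [P.outDeriv_eq, show k * l h - Real.pi / 2 = 0 from hxh]
    simp
  have hsum' : ∑ h ∈ H, Real.tan (-x h) = 0 := by
    simp_rw [Real.tan_neg, Finset.sum_neg_distrib]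
    simpa [hx] using hsum
  have hpos := Real.exists_pos_of_sum_tan_eq_zero H hHne x h0 hne hsum
  have hneg := Real.exists_pos_of_sum_tan_eq_zero H hHne (fun h => -x h)
    (fun h hh => neg_lt_neg (h1 h hh)) (fun h hh => neg_ne_zero.2 (hne h hh)) hsum'
  -- The positive angles are counted by `ξ` and the negative ones by `deg v - ξ`, so the bound for
  -- `x` is the upper bound on the capacity and the bound for `-x` the lower one.
  have hup := Real.sum_le_of_sum_tan_eq_zero H x h0 h1 hsum hpos
  have hlow := Real.sum_le_of_sum_tan_eq_zero H (fun h => -x h)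
    (fun h hh => neg_lt_neg (h1 h hh)) (fun h hh => by linarith [h0 h hh]) hsum' hneg
  have hcard : (H.filter fun h => 0 < x h).card + (H.filter fun h => 0 < -x h).card = H.card := by
    rw [← Finset.card_filter_add_card_filter_not (s := H) (fun h => 0 < x h)]
    congr 2
    refine Finset.filter_congr fun h hh => ?_
    rw [neg_pos, not_lt]
    exact ⟨le_of_lt, fun hle => hle.lt_of_ne (hne h hh)⟩
  have hcpos : 0 < (H.filter fun h => 0 < x h).card := by
    obtain ⟨h, hh, hxh⟩ := hpos
    exact Finset.card_pos.2 ⟨h, Finset.mem_filter.2 ⟨hh, hxh⟩⟩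
  have hcneg : 0 < (H.filter fun h => 0 < -x h).card := by
    obtain ⟨h, hh, hxh⟩ := hneg
    exact Finset.card_pos.2 ⟨h, Finset.mem_filter.2 ⟨hh, hxh⟩⟩
  rw [hd] at hrho
  rw [hxi, hd]
  have hcard' : ((H.filter fun h => 0 < x h).card : ℝ) + (H.filter fun h => 0 < -x h).card
      = H.card := by exact_mod_cast hcard
  rw [Finset.sum_neg_distrib] at hlow
  refine ⟨hcpos, by omega, ?_, ?_⟩
  · refine le_of_mul_le_mul_right ?_ hpi
    rw [hrho, ← hcard']
    linarith
  · refine le_of_mul_le_mul_right ?_ hpi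
    rw [hrho]
    linarith

/-- The star at a vertex of degree one is a quarter of a wave. -/
theorem starAt_of_degree_eq_one (P : Γ.Profile k f l D) {lam : ℝ}
    (hf : Γ.IsEigenfunction lam f) {v : V} (hdeg : Γ.degree v = 1) :
    Γ.neumannCount f (Γ.starAt l v) = 0 ∧ Γ.wavelengthCapacity k (Γ.starAt l v) = 1 / 2 := by
  classical
  have hpi := Real.pi_pos
  have hsum := P.sum_tan_eq_zero hf v
  have hrho := P.wavelengthCapacity_starAt v
  obtain ⟨h, hh⟩ := ncard_eq_one.1 hdeg
  have hmem : ∀ h', Γ.endpt h'.1 h'.2 = v ↔ h' = h := fun h' => by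
    have : h' ∈ {h : E × Bool | Γ.endpt h.1 h.2 = v} ↔ h' = h := by rw [hh]; exact Iff.rfl
    exact this
  have hH : Finset.univ.filter (fun h : E × Bool => Γ.endpt h.1 h.2 = v) = {h} := by
    ext h'
    simp [hmem]
  rw [hH, Finset.sum_singleton] at hsum hrho
  have h0 : -(Real.pi / 2) < k * l h - Real.pi / 2 := by
    linarith [mul_pos P.k_pos (P.dist_pos h)]
  have h1 : k * l h - Real.pi / 2 < Real.pi / 2 := by linarith [P.lt_pi h]
  have hx : k * l h - Real.pi / 2 = 0 :=
    Real.injOn_tan ⟨h0, h1⟩ ⟨by linarith, by linarith⟩ (by rw [hsum, Real.tan_zero])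
  constructor
  · rw [neumannCount, P.ncard_neumannPointsIn_starAt]
    convert ncard_empty (E × Bool)
    ext h'
    simp only [mem_ofPred_eq, mem_empty_iff_false, iff_false, hmem]
    rintro ⟨rfl, hlt⟩
    exact hlt.ne' hx
  · rw [hx, hdeg] at hrho
    push_cast at hrho
    refine mul_right_cancel₀ hpi.ne' ?_
    rw [hrho]
    ring

end Profile

end MetricGraph

/-! ### The main theorem -/

theorem propositionC1 {V E : Type*} [Fintype V] [Fintype E] (Γ : MetricGraph V E)
    (hΓ : Γ.IsStandard) (k : ℝ) (hk : Real.pi / Γ.minLen < k)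
    (f : Γ.Pt → ℂ) (hf : Γ.IsGenericEigenfunction (k ^ 2) f)
    (Ω : Set Γ.Pt) (hΩ : Γ.IsNodalDomain f Ω) :
    (Γ.neumannPointsIn f Ω).Finite ∧ (Γ.boundary f Ω).Finite ∧
    ((∀ v, Γ.degree v = 1 → Γ.vtx v ∉ Ω) →
      1 ≤ Γ.neumannCount f Ω ∧ (1 : ℝ) ≤ ((Γ.neumannCount f Ω : ℝ) + 1) / 2) ∧
    (Γ.neumannCount f Ω : ℤ) ≤ ((Γ.boundary f Ω).ncard : ℤ) - 1 ∧
    ((Γ.neumannCount f Ω : ℝ) + 1) / 2 ≤ Γ.wavelengthCapacity k Ω ∧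
    Γ.wavelengthCapacity k Ω ≤
      ((Γ.neumannCount f Ω : ℝ) + ((Γ.boundary f Ω).ncard : ℝ) - 1) / 2 ∧
    ((Γ.neumannCount f Ω : ℝ) + ((Γ.boundary f Ω).ncard : ℝ) - 1) / 2 ≤
      ((Γ.boundary f Ω).ncard : ℝ) - 1 := by
  obtain ⟨l, D, P⟩ := MetricGraph.exists_profile hΓ hk hf
  have hk0 := P.k_pos
  have hpi := Real.pi_pos
  rcases P.nodalDomain_cases hf.eigen.continuous hΩ with
    ⟨v, rfl⟩ | ⟨e, a, D', ha, hb, hD, hf', rfl⟩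
  · have hfin : (Γ.nodalBoundary f (Γ.starAt l v)).Finite := by
      rw [P.nodalBoundary_starAt]
      exact (toFinite _).image _
    refine ⟨by rw [P.neumannPointsIn_starAt]; exact (toFinite _).image _,
      Γ.finite_boundary hfin, ?_⟩
    rw [Γ.ncard_boundary hfin, P.ncard_nodalBoundary_starAt]
    by_cases hdeg : Γ.degree v = 1
    · obtain ⟨h1, h2⟩ := P.starAt_of_degree_eq_one hf.eigen hdeg
      -- Here the boundary has two points, `v` itself and the nodal point ending the single arm;
      -- with `ξ = 0` and `ρ = 1/2` the first two capacity bounds are equalities.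
      have hv : {u | Γ.degree u = 1 ∧ Γ.vtx u ∈ Γ.starAt l v} = {v} := by
        ext u
        constructor
        · exact fun hu => hu.2
        · rintro rfl
          exact ⟨hdeg, rfl⟩
      rw [h1, h2, hv, ncard_singleton, hdeg]
      exact ⟨fun h => absurd rfl (h v hdeg), by norm_num⟩
    · obtain ⟨h1, h2, h3, h4⟩ := P.starAt_bounds hΓ hf hdeg
      have hv : {u | Γ.degree u = 1 ∧ Γ.vtx u ∈ Γ.starAt l v} = ∅ := by
        ext u
        refine ⟨?_, False.elim⟩
        rintro ⟨hu, huv⟩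
        obtain rfl : u = v := huv
        exact hdeg hu
      rw [hv, ncard_empty, zero_add]
      have h1' : (1 : ℝ) ≤ Γ.neumannCount f (Γ.starAt l v) := by exact_mod_cast h1
      have h2' : (Γ.neumannCount f (Γ.starAt l v) : ℝ) + 1 ≤ Γ.degree v := by exact_mod_cast h2
      exact ⟨fun _ => ⟨h1, by linarith⟩, by omega, h3, h4, by linarith⟩
  · have hd : 0 < Real.pi / k := div_pos hpi hk0
    have hN := MetricGraph.neumannPointsIn_segment hk0 ha hb hD hf'
    have hfa : f (Γ.pt e a) = 0 := by
      rw [hf' a ⟨ha.le, by linarith⟩]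
      simp
    have hfb : f (Γ.pt e (a + Real.pi / k)) = 0 := by
      rw [hf' _ ⟨by linarith, hb.le⟩, add_sub_cancel_left, mul_div_cancel₀ _ hk0.ne']
      simp
    have hnz : ∀ x ∈ Ioo a (a + Real.pi / k), f (Γ.pt e x) ≠ 0 := by
      intro x hx
      rw [hf' x ⟨by linarith [hx.1], by linarith [hx.2]⟩]
      refine mul_ne_zero hD ?_
      have : x - a < Real.pi / k := by linarith [hx.2]
      rw [lt_div_iff₀ hk0, mul_comm] at this
      exact_mod_cast (Real.sin_pos_of_pos_of_lt_pi (mul_pos hk0 (by linarith [hx.1])) this).ne'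
    have hB := MetricGraph.nodalBoundary_segment ha (by linarith) hb hfa hfb hnz
    have hfin : (Γ.nodalBoundary f (Γ.segment e a (a + Real.pi / k))).Finite := by
      rw [hB]
      exact toFinite _
    have hxi : Γ.neumannCount f (Γ.segment e a (a + Real.pi / k)) = 1 := by
      rw [MetricGraph.neumannCount, hN, ncard_singleton]
    have hcard : (Γ.boundary f (Γ.segment e a (a + Real.pi / k))).ncard = 2 := by
      have hv : {u | Γ.degree u = 1 ∧ Γ.vtx u ∈ Γ.segment e a (a + Real.pi / k)} = ∅ := by
        ext u
        exact ⟨fun hu => hu.2, False.elim⟩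
      rw [Γ.ncard_boundary hfin, hv, ncard_empty, hB, ncard_pair (by simp)]
    have hrho : Γ.wavelengthCapacity k (Γ.segment e a (a + Real.pi / k)) = 1 := by
      rw [MetricGraph.wavelengthCapacity, MetricGraph.totalLen_segment ha.le (by linarith) hb.le]
      field_simp
      ring
    refine ⟨by rw [hN]; exact toFinite _, Γ.finite_boundary hfin, ?_⟩
    rw [hxi, hcard, hrho]
    norm_num
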